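/- For a finite signed Borel measure $W$ on $\mathbb R$, with Jordan decomposition $W=W^+-W^-$, put $\|W\|_{\mathcal M}=W^+(\mathbb R)+W^-(\mathbb R)$, $\widehat W(\xi)=\int_{\mathbb R} e^{-ix\xi}\,dW(x)$ and $(W*f)(x)=\int_{\mathbb R} f(x-y)\,dW(y)$. Let $\mathcal E_{\rm odd}$ be the set of odd real-valued $v\in H^1_{\rm loc}(\mathbb R)$ (identified with their continuous representatives) with $v'\in L^2(\mathbb R)$ and $1-v^2\in L^2(\mathbb R)$, and let $$E_W(v)=\frac12\int_{\mathbb R}|v'|^2\,dx+\frac14\int_{\mathbb R}\big(W*(1-v^2)\big)(1-v^2)\,dx .$$ **Theorem 1.6.** Let $\lambda_*\in(0,\infty)$ and let $(\mathcal W_\lambda)_{\lambda\in(0,\lambda_*)}$ be a family of even finite signed Borel measures on $\mathbb R$ with $\widehat{\mathcal W_\lambda}(0)=1$, such that 1. there is $\kappa\ge 0$, independent of $\lambda$, with $\widehat{\mathcal W_\lambda}(\xi)\ge \max(1-\kappa\xi^2,0)$ for a.e. $\xi\in\mathbb R$ and every $\lambda\in(0,\lambda_*)$; 2. for some $\alpha\ge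 0$ and a.e. $\xi\in\mathbb R$, $\widehat{\mathcal W_\lambda^+}(\xi)\to 1+\alpha$ and $\widehat{\mathcal W_\lambda^-}(\xi)\to\alpha$ as $\lambda\to0^+$; 3. $\sup_{\lambda\in(0,\lambda_*)}\|\mathcal W_\lambda\|_{\mathcal M}<\infty$. For every $\lambda\in(0,\lambda_*)$ let $u_\lambda\in\mathcal E_{\rm odd}$ be a weak solution of $u''+u\,\big(\mathcal W_\lambda*(1-u^2)\big)=0$ on $\mathbb R$ which minimizes $E_{\mathcal W_\lambda}$ over $\mathcal E_{\rm odd}$ and satisfies $u_\lambda(x)\to\pm1$ as $x\to\pm\infty$. Let $\boldsymbol u(x)=\tanh(x/\sqrt2)$. Then, as $\lambda\to0^+$, $u_\lambda\to\boldsymbol u$ in $W^{k,\infty}_{\rm loc}(\mathbb R)$ for every integer $k\ge0$ (where, for each $k$, $u_\lambda$ is of class $C^k$ for all sufficiently small $\lambda$), weakly-$*$ in $L^\infty(\mathbb R)$, and weakly in $\dot H^1(\mathbb R)$ (that is, $u_\lambda'\rightharpoonup\boldsymbol u'$ weakly in $L^2(\mathbb R)$). -/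

import Mathlib

open MeasureTheory Filter Topology Set
open scoped ENNReal ContDiff

noncomputable section

namespace NonlocalGP

/-! ### Weak derivatives on the line -/

/-- Test functions: smooth and compactly supported. -/
def IsTestFunction (φ : ℝ → ℝ) : Prop :=
  ContDiff ℝ ∞ φ ∧ HasCompactSupport φ

/-- `g` is a weak (distributional) derivative of `u`, both being locally integrable. -/
def HasWeakDeriv (u g : ℝ → ℝ) : Prop :=
  LocallyIntegrable u volume ∧ LocallyIntegrable g volume ∧
    ∀ φ : ℝ → ℝ, IsTestFunction φ → ∫ x, u x * deriv φ x = -∫ x, g x * φ x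

open Classical in
/-- The weak derivative of `u` (determined up to a null set), and `0` if there is none. -/
def weakDeriv (u : ℝ → ℝ) : ℝ → ℝ :=
  if h : ∃ g, HasWeakDeriv u g then h.choose else 0

/-! ### Signed measures: elements of `𝓜(ℝ)` are `SignedMeasure ℝ` -/

/-- The positive part of the Jordan decomposition. -/
def jordanPos (W : SignedMeasure ℝ) : Measure ℝ := W.toJordanDecomposition.posPart

/-- The negative part of the Jordan decomposition. -/
def jordanNeg (W : SignedMeasure ℝ) : Measure ℝ := W.toJordanDecomposition.negPart

/-- The total variation norm of a signed measure, as an extended nonnegative number. -/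
def tvNorm (W : SignedMeasure ℝ) : ℝ≥0∞ := jordanPos W univ + jordanNeg W univ

/-- Fourier transform `∫ exp (-i x ξ) dμ(x)` of a (finite) positive measure. -/
def fourierMeasure (μ : Measure ℝ) (ξ : ℝ) : ℂ :=
  ∫ x, Complex.exp (-(Complex.I * x * ξ)) ∂μ

/-- Fourier transform of a signed measure. It is real-valued when the measure is even. -/
def fourierSigned (W : SignedMeasure ℝ) (ξ : ℝ) : ℂ :=
  fourierMeasure (jordanPos W) ξ - fourierMeasure (jordanNeg W) ξ

/-- Convolution `(W * f)(x) = ∫ f (x - y) dW(y)`. -/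
def conv (W : SignedMeasure ℝ) (f : ℝ → ℝ) (x : ℝ) : ℝ :=
  ∫ y, f (x - y) ∂(jordanPos W) - ∫ y, f (x - y) ∂(jordanNeg W)

/-- The measure is invariant under `x ↦ -x`. -/
def IsEvenMeasure (W : SignedMeasure ℝ) : Prop :=
  ∀ A : Set ℝ, MeasurableSet A → W (Neg.neg ⁻¹' A) = W A

/-- The standing assumption: `W` is an even finite signed measure with `Ŵ(0) = 1`. -/
structure IsNormalizedPotential (W : SignedMeasure ℝ) : Prop where
  even : IsEvenMeasure W
  fourier_zero : fourierSigned W 0 = 1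

/-- `Ŵ(ξ) ≥ (1 - κ ξ²)⁺` for almost every `ξ`. -/
def FourierLowerBound (W : SignedMeasure ℝ) (κ : ℝ) : Prop :=
  ∀ᵐ ξ : ℝ, max (1 - κ * ξ ^ 2) 0 ≤ (fourierSigned W ξ).re

/-! ### Energy space, energy, and odd minimizers -/

/-- The density deficit `η = 1 - u²`. -/
def deficit (u : ℝ → ℝ) (x : ℝ) : ℝ := 1 - u x ^ 2

/-- The odd energy space: real-valued odd `u ∈ H¹_loc` with `1 - u² ∈ L²` and `u' ∈ L²`. As usual,
a function in `H¹_loc(ℝ)` is identified with its continuous representative. -/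
structure MemEnergyOdd (u : ℝ → ℝ) : Prop where
  continuous : Continuous u
  hasWeakDeriv : HasWeakDeriv u (weakDeriv u)
  weakDeriv_memLp : MemLp (weakDeriv u) 2 volume
  deficit_memLp : MemLp (deficit u) 2 volume
  odd : ∀ x, u (-x) = -u x

/-- The energy `½ ∫ |u'|² + ¼ ∫ (W * (1 - u²)) (1 - u²)`. -/
def energy (W : SignedMeasure ℝ) (u : ℝ → ℝ) : ℝ :=
  (1 / 2) * (∫ x, weakDeriv u x ^ 2) + (1 / 4) * ∫ x, conv W (deficit u) x * deficit u x

/-- `u` solves `u'' + u (W * (1 - u²)) = 0` on `ℝ` in the weak sense. -/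
def IsWeakSolution (W : SignedMeasure ℝ) (u : ℝ → ℝ) : Prop :=
  ∀ φ : ℝ → ℝ, IsTestFunction φ →
    ∫ x, weakDeriv u x * deriv φ x = ∫ x, u x * conv W (deficit u) x * φ x

/-- An odd minimizer black soliton: an odd finite energy solution which minimizes the energy among
odd functions, with the orientation `u(±∞) = ±1`. -/
structure IsOddMinimizerSoliton (W : SignedMeasure ℝ) (u : ℝ → ℝ) : Prop where
  mem : MemEnergyOdd u
  solution : IsWeakSolution W u
  minimal : ∀ v, MemEnergyOdd v → energy W u ≤ energy W v
  tendsto_atTop : Tendsto u atTop (𝓝 1)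
  tendsto_atBot : Tendsto u atBot (𝓝 (-1))

/-- The black soliton of the local equation, `x ↦ tanh (x / √2)`. -/
def localBlackSoliton (x : ℝ) : ℝ := Real.tanh (x / Real.sqrt 2)

/-! ### Modes of convergence -/

/-- Convergence in `W^{k,∞}_loc(ℝ)` of functions of class `C^k` (whose weak derivatives up to order
`k` are the classical ones): the `W^{k,∞}(-R,R)` norm of the difference tends to `0`
for every `R > 0`. -/
def TendstoWkInftyLoc (k : ℕ) (u : ℝ → ℝ → ℝ) (l : Filter ℝ) (u₀ : ℝ → ℝ) : Prop :=
  (∀ᶠ t in l, ContDiff ℝ k (u t)) ∧ ContDiff ℝ k u₀ ∧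
    ∀ R : ℝ, 0 < R →
      Tendsto (fun t => ∑ j ∈ Finset.range (k + 1),
        eLpNorm (fun x => iteratedDeriv j (u t) x - iteratedDeriv j u₀ x) ∞
          (volume.restrict (Ioo (-R) R))) l (𝓝 0)

/-- Weak-* convergence in `L^∞(ℝ)`, the dual of `L¹(ℝ)`. -/
def TendstoWeakStarLInfty (u : ℝ → ℝ → ℝ) (l : Filter ℝ) (u₀ : ℝ → ℝ) : Prop :=
  (∀ᶠ t in l, MemLp (u t) ∞ volume) ∧ MemLp u₀ ∞ volume ∧
    ∀ φ : ℝ → ℝ, Integrable φ volume →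
      Tendsto (fun t => ∫ x, u t x * φ x) l (𝓝 (∫ x, u₀ x * φ x))

/-- `u` belongs to the homogeneous Sobolev space `Ḣ¹(ℝ)`: it has a weak derivative in `L²`. -/
def MemHomSobolev (u : ℝ → ℝ) : Prop :=
  HasWeakDeriv u (weakDeriv u) ∧ MemLp (weakDeriv u) 2 volume

/-- Weak convergence in `Ḣ¹(ℝ)`: weak convergence of the derivatives in `L²(ℝ)`. -/
def TendstoWeakHomSobolev (u : ℝ → ℝ → ℝ) (l : Filter ℝ) (u₀ : ℝ → ℝ) : Prop :=
  (∀ᶠ t in l, MemHomSobolev (u t)) ∧ MemHomSobolev u₀ ∧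
    ∀ φ : ℝ → ℝ, MemLp φ 2 volume →
      Tendsto (fun t => ∫ x, weakDeriv (u t) x * φ x) l (𝓝 (∫ x, weakDeriv u₀ x * φ x))

end NonlocalGP

end

/-! Write w for `localBlackSoliton`, g = 1 - w², h = w² - u² for `deficitGap u`, and B(f, k) for
`nonlocalForm W f k`. Since w'' + g w = 0 and w > 0 on (0, ∞), w is a ground state of -d²/dx² - g on
the half-line. With a = w'/w and r = u' - a u, this gives ∫ u'² - ∫ g u² = 2 ∫_{x>0} r² for odd
solitons u (`integral_sq_sub_eq_remainder`), and the value 0 for u = w.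

Minimality is used only through E_W(u) ≤ E_W(w). Expanding B around g and replacing every term that
contains g by the L² product costs a multiple of ‖(Ŵ - 1) ĝ‖, which tends to 0 by dominated
convergence. What remains is exactly the quadratic form above, so ∫_{x>0} r² + B(h, h)/4 is small
(`remainder_add_nonlocalForm_le`). Both terms are nonnegative because Ŵ ≥ 0, hence both tend to 0.

The rest is rigidity. Since (u/w)' = r/w, the ratio u/w is nearly constant on compact subsets of (0,
∞). Cauchy–Schwarz for B turns B(h, h) → 0 into ∫ h g → 0, which forces the square of that constant
to tend to 1. Then h' = 2 a h - 2 u r tends to 0 in L², and Ŵ ≥ 1 - κξ² gives ∫ h² ≤ B(h, h) + κ ∫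
h'² (`integral_sq_le_nonlocalForm_add`). So h → 0 in H¹, hence uniformly, and the limit 1 at +∞
selects the sign: u → w uniformly on the line. No subsequence is extracted.

The estimates need bounds independent of the parameter. Energy, coercivity and Agmon's inequality
bound u in sup norm (`abs_deficit_le`). The equation then bounds all derivatives, because
convolution with W is bounded by the total variation. Interpolation upgrades uniform convergence to
convergence of all derivatives. Weak-* convergence is dominated convergence, and u' even converges
strongly in L², since u' - w' = r + a (u - w). -/

noncomputable section

namespace NonlocalGP

/-! ### The `L²` Fourier transform and translations -/

open FourierTransform in
/-- The `L²` Fourier transform (with kernel `exp (-2πixξ)`) of a real square integrable function. -/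
def fourierL2 (f : ℝ → ℝ) : ℝ → ℂ :=
  open Classical in
  if h : MemLp (fun x => (f x : ℂ)) 2 volume then ⇑(𝓕 (h.toLp _) : Lp ℂ 2 (volume : Measure ℝ))
  else 0

theorem memLp_fourierL2 (f : ℝ → ℝ) : MemLp (fourierL2 f) 2 volume := by
  unfold fourierL2
  split_ifs with h
  · exact Lp.memLp _
  · exact MemLp.zero

/-- The phase factor `exp (-2πiyξ)`. -/
def phase (y ξ : ℝ) : ℂ := Complex.exp (-(Complex.I * y * (2 * Real.pi * ξ : ℝ)))

theorem continuous_phase : Continuous fun p : ℝ × ℝ => phase p.1 p.2 := by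
  unfold phase; fun_prop

theorem continuous_phase_right (y : ℝ) : Continuous (phase y) := by
  unfold phase; fun_prop

theorem norm_phase (y ξ : ℝ) : ‖phase y ξ‖ = 1 := by
  have : -(Complex.I * y * (2 * Real.pi * ξ : ℝ)) = ((-(y * (2 * Real.pi * ξ)) : ℝ) : ℂ) * Complex.I := by
    push_cast; ring
  rw [phase, this, Complex.norm_exp_ofReal_mul_I]

theorem memLp_phase (y : ℝ) : MemLp (phase y) ∞ volume :=
  memLp_top_of_bound (continuous_phase_right y).aestronglyMeasurable 1
    (Eventually.of_forall fun ξ => (norm_phase y ξ).le)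

open FourierTransform SchwartzMap in
theorem fourier_compSubConst (f : 𝓢(ℝ, ℂ)) (y ξ : ℝ) :
    (𝓕 (f.compSubConstCLM ℂ y)) ξ = phase y ξ * (𝓕 f) ξ := by
  rw [fourier_coe, fourier_coe]
  have h := congrFun (VectorFourier.fourierIntegral_comp_add_right Real.fourierChar volume (innerₗ ℝ) (⇑f) (-y)) ξ
  have h2 : (⇑(f.compSubConstCLM ℂ y) : ℝ → ℂ) = (⇑f ∘ fun v => v + -y) := by
    ext x; simp [sub_eq_add_neg]
  rw [h2]
  refine h.trans ?_
  rw [Circle.smul_def, Real.fourierChar_apply, smul_eq_mul]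
  congr 2
  simp
  ring

-- Both sides are continuous in `f` for the L² norm and agree on Schwartz functions, which are
-- dense.
open FourierTransform SchwartzMap in
theorem fourier_translate (f : Lp ℂ 2 (volume : Measure ℝ)) (y : ℝ) :
    (𝓕 (Lp.compMeasurePreserving (fun x => x - y) (measurePreserving_sub_right volume y) f) :
      Lp ℂ 2 (volume : Measure ℝ)) = (memLp_phase y).toLp (phase y) • (𝓕 f : Lp ℂ 2 volume) := by
  refine DenseRange.induction_on (p := fun f : Lp ℂ 2 (volume : Measure ℝ) =>
    (𝓕 (Lp.compMeasurePreserving (fun x => x - y) (measurePreserving_sub_right volume y) f) :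
      Lp ℂ 2 (volume : Measure ℝ)) = (memLp_phase y).toLp (phase y) • (𝓕 f : Lp ℂ 2 volume))
    (SchwartzMap.denseRange_toLpCLM (p := 2) ENNReal.ofNat_ne_top) f ?_ ?_
  · refine isClosed_eq ?_ ?_
    · exact (Lp.fourierTransformₗᵢ ℝ ℂ).continuous.comp (Lp.isometry_compMeasurePreserving _).continuous
    · exact (((ContinuousLinearMap.lsmul ℂ ℂ).holderL volume ∞ 2 2
        ((memLp_phase y).toLp (phase y))).continuous).comp (Lp.fourierTransformₗᵢ ℝ ℂ).continuous
  · intro φ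
    have h1 : Lp.compMeasurePreserving (fun x => x - y) (measurePreserving_sub_right volume y)
        (φ.toLp 2) = (φ.compSubConstCLM ℂ y).toLp 2 := rfl
    change (𝓕 (Lp.compMeasurePreserving (fun x => x - y) (measurePreserving_sub_right volume y)
        (φ.toLp 2)) : Lp ℂ 2 (volume : Measure ℝ)) = _ • (𝓕 (φ.toLp 2) : Lp ℂ 2 volume)
    rw [h1, SchwartzMap.toLp_fourier_eq, SchwartzMap.toLp_fourier_eq]
    apply Lp.ext
    filter_upwards [SchwartzMap.coeFn_toLp (𝓕 (φ.compSubConstCLM ℂ y)) 2 volume,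
      SchwartzMap.coeFn_toLp (𝓕 φ) 2 volume, (memLp_phase y).coeFn_toLp,
      Lp.coeFn_lpSMul (r := 2) ((memLp_phase y).toLp (phase y)) ((𝓕 φ).toLp 2)] with ξ h1 h2 h3 h4
    rw [h1, h4, Pi.smul_apply', h2, h3, fourier_compSubConst, smul_eq_mul]

/-- Parseval applied to a translate of `f`. Plancherel (y = 0), the symbol of the nonlocal form and
the difference quotients are all read off from this identity. -/
theorem integral_translate_mul {f g : ℝ → ℝ} (hf : MemLp f 2 volume) (hg : MemLp g 2 volume)
    (y : ℝ) :
    ((∫ x, f (x - y) * g x : ℝ) : ℂ)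
      = ∫ ξ, phase y ξ * fourierL2 f ξ * (starRingEnd ℂ) (fourierL2 g ξ) := by
  have hf' : MemLp (fun x => (f x : ℂ)) 2 volume := hf.ofReal
  have hg' : MemLp (fun x => (g x : ℂ)) 2 volume := hg.ofReal
  have key := Lp.inner_fourier_eq (hg'.toLp _)
    (Lp.compMeasurePreserving (fun x => x - y) (measurePreserving_sub_right volume y) (hf'.toLp _))
  rw [fourier_translate, L2.inner_def, L2.inner_def] at key
  have h1 : fourierL2 f = ⇑(FourierTransform.fourier (hf'.toLp _) : Lp ℂ 2 (volume : Measure ℝ)) := by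
    rw [fourierL2, dif_pos hf']
  have h2 : fourierL2 g = ⇑(FourierTransform.fourier (hg'.toLp _) : Lp ℂ 2 (volume : Measure ℝ)) := by
    rw [fourierL2, dif_pos hg']
  rw [← integral_complex_ofReal]
  calc _ = _ := ?_
    _ = _ := key.symm
    _ = _ := ?_
  · refine integral_congr_ae ?_
    rw [Lp.toLp_compMeasurePreserving]
    filter_upwards [hg'.coeFn_toLp, (hf'.comp_measurePreserving
      (measurePreserving_sub_right volume y)).coeFn_toLp] with x h3 h4
    rw [h3, h4]
    simp
  · refine integral_congr_ae ?_
    filter_upwards [(memLp_phase y).coeFn_toLp, Lp.coeFn_lpSMul (r := 2)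
      ((memLp_phase y).toLp (phase y)) (FourierTransform.fourier (hf'.toLp _) : Lp ℂ 2 volume)]
      with ξ h3 h4
    rw [h4, Pi.smul_apply', h3, h1, h2]
    simp

/-! ### Square integrable functions on the line -/

theorem MemLp.integrable_mul_two {f g : ℝ → ℝ} {μ : Measure ℝ} (hf : MemLp f 2 μ)
    (hg : MemLp g 2 μ) : Integrable (fun x => f x * g x) μ :=
  MemLp.integrable_mul hf hg

/-- The Cauchy–Schwarz inequality. -/
theorem integral_mul_sq_le {f g : ℝ → ℝ} {μ : Measure ℝ} (hf : MemLp f 2 μ) (hg : MemLp g 2 μ) :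
    (∫ x, |f x| * |g x| ∂μ) ^ 2 ≤ (∫ x, f x ^ 2 ∂μ) * ∫ x, g x ^ 2 ∂μ := by
  have h := integral_mul_le_Lp_mul_Lq_of_nonneg (μ := μ) (f := fun x => |f x|)
    (g := fun x => |g x|) Real.HolderConjugate.two_two
    (Eventually.of_forall fun x => abs_nonneg _) (Eventually.of_forall fun x => abs_nonneg _)
    (by simpa using hf.norm) (by simpa using hg.norm)
  simp only [Real.rpow_two, sq_abs, ← Real.sqrt_eq_rpow] at h
  have h0 : 0 ≤ ∫ x, |f x| * |g x| ∂μ := integral_nonneg fun x => by positivity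
  calc _ ≤ (√(∫ x, f x ^ 2 ∂μ) * √(∫ x, g x ^ 2 ∂μ)) ^ 2 := by gcongr
    _ = _ := by
      rw [mul_pow, Real.sq_sqrt (integral_nonneg fun x => sq_nonneg _),
        Real.sq_sqrt (integral_nonneg fun x => sq_nonneg _)]

theorem abs_integral_mul_le {f g : ℝ → ℝ} {μ : Measure ℝ} (hf : MemLp f 2 μ) (hg : MemLp g 2 μ) :
    |∫ x, f x * g x ∂μ| ≤ √(∫ x, f x ^ 2 ∂μ) * √(∫ x, g x ^ 2 ∂μ) := by
  rw [← Real.sqrt_mul (integral_nonneg fun x => sq_nonneg _)]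
  refine Real.le_sqrt_of_sq_le ?_
  refine le_trans ?_ (integral_mul_sq_le hf hg)
  gcongr
  refine (abs_integral_le_integral_abs).trans_eq ?_
  simp [abs_mul]

theorem MemLp.translate {f : ℝ → ℝ} (hf : MemLp f 2 volume) (y : ℝ) :
    MemLp (fun x => f (x - y)) 2 volume :=
  hf.comp_measurePreserving (measurePreserving_sub_right volume y)

theorem integral_norm_fourierL2_sq {f : ℝ → ℝ} (hf : MemLp f 2 volume) :
    ∫ ξ, ‖fourierL2 f ξ‖ ^ 2 = ∫ x, f x ^ 2 := by
  have h := integral_translate_mul hf hf 0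
  have h2 : ∀ ξ, phase 0 ξ * fourierL2 f ξ * (starRingEnd ℂ) (fourierL2 f ξ)
      = ((‖fourierL2 f ξ‖ ^ 2 : ℝ) : ℂ) := fun ξ => by
    rw [mul_assoc, Complex.mul_conj']; simp [phase]
  simp only [h2, integral_complex_ofReal, sub_zero] at h
  rw [← Complex.ofReal_inj, ← h]
  simp [sq]

theorem integrable_norm_fourierL2_sq (f : ℝ → ℝ) :
    Integrable (fun ξ => ‖fourierL2 f ξ‖ ^ 2) volume :=
  (memLp_two_iff_integrable_sq_norm (memLp_fourierL2 f).1).1 (memLp_fourierL2 f)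

theorem integrable_fourierL2_mul_conj (f g : ℝ → ℝ) :
    Integrable (fun ξ => fourierL2 f ξ * (starRingEnd ℂ) (fourierL2 g ξ)) volume :=
  MemLp.integrable_mul (memLp_fourierL2 f) (memLp_fourierL2 g).star

/-! ### Convolution with a finite measure in Fourier variables -/

theorem continuous_fourierMeasure (μ : Measure ℝ) [IsFiniteMeasure μ] :
    Continuous fun ξ => fourierMeasure μ (2 * Real.pi * ξ) := by
  unfold fourierMeasure
  refine continuous_of_dominated (bound := fun _ => 1) (fun ξ => ?_) (fun ξ => ?_)
    (integrable_const _) ?_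
  · exact (Continuous.aestronglyMeasurable (by fun_prop))
  · exact Eventually.of_forall fun x => (norm_phase x ξ).le
  · exact Eventually.of_forall fun x => by fun_prop

theorem norm_fourierMeasure_le (μ : Measure ℝ) [IsFiniteMeasure μ] (ξ : ℝ) :
    ‖fourierMeasure μ (2 * Real.pi * ξ)‖ ≤ μ.real univ := by
  refine (norm_integral_le_integral_norm _).trans ?_
  have : ∀ x : ℝ, ‖Complex.exp (-(Complex.I * x * (2 * Real.pi * ξ : ℝ)))‖ = 1 :=
    fun x => norm_phase x ξ
  simp only [this]
  simp

/-- Translation invariance and |ab| ≤ a² + b² bound every slice in x by a constant independent of y,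
and `μ` is finite. This licenses Fubini for convolutions. -/
theorem integrable_prod_translate_mul {f g : ℝ → ℝ} (μ : Measure ℝ) [IsFiniteMeasure μ]
    (hfc : Continuous f) (hgc : Continuous g) (hf : MemLp f 2 volume) (hg : MemLp g 2 volume) :
    Integrable (fun p : ℝ × ℝ => f (p.1 - p.2) * g p.1) (volume.prod μ) := by
  have hm : AEStronglyMeasurable (fun p : ℝ × ℝ => f (p.1 - p.2) * g p.1) (volume.prod μ) :=
    Continuous.aestronglyMeasurable (by fun_prop)
  rw [integrable_prod_iff' hm]
  refine ⟨Eventually.of_forall fun y => MemLp.integrable_mul_two (MemLp.translate hf y) hg, ?_⟩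
  refine Integrable.mono' (integrable_const ((∫ x, f x ^ 2) + ∫ x, g x ^ 2))
    hm.norm.prod_swap.integral_prod_right' (Eventually.of_forall fun y => ?_)
  have h0 : 0 ≤ ∫ x, ‖f (x - y) * g x‖ := integral_nonneg fun x => norm_nonneg _
  rw [Real.norm_of_nonneg h0]
  have e : ∫ x, f x ^ 2 = ∫ x, f (x - y) ^ 2 := (integral_sub_right_eq_self (fun x => f x ^ 2) y).symm
  rw [e, ← integral_add (MemLp.translate hf y).integrable_sq hg.integrable_sq]
  refine integral_mono (MemLp.integrable_mul_two (MemLp.translate hf y) hg).norm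
    ((MemLp.translate hf y).integrable_sq.add hg.integrable_sq) fun x => ?_
  simp only [Real.norm_eq_abs, abs_mul]
  nlinarith [sq_nonneg (|f (x - y)| - |g x|), sq_abs (f (x - y)), sq_abs (g x)]

theorem integrable_convMeasure_mul {f g : ℝ → ℝ} (μ : Measure ℝ) [IsFiniteMeasure μ]
    (hfc : Continuous f) (hgc : Continuous g) (hf : MemLp f 2 volume) (hg : MemLp g 2 volume) :
    Integrable (fun x => (∫ y, f (x - y) ∂μ) * g x) volume := by
  simpa [integral_mul_const] using
    (integrable_prod_translate_mul μ hfc hgc hf hg).integral_prod_left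

/-- Fubini is used twice with Parseval in between: the phases, integrated in y, rebuild the Fourier
transform of `μ`. The factor 2π reconciles the kernel exp(-ixξ) for measures with exp(-2πixξ) for
functions. -/
theorem integral_convMeasure_mul {f g : ℝ → ℝ} (μ : Measure ℝ) [IsFiniteMeasure μ]
    (hfc : Continuous f) (hgc : Continuous g) (hf : MemLp f 2 volume) (hg : MemLp g 2 volume) :
    ((∫ x, (∫ y, f (x - y) ∂μ) * g x : ℝ) : ℂ) = ∫ ξ, fourierMeasure μ (2 * Real.pi * ξ) *
      (fourierL2 f ξ * (starRingEnd ℂ) (fourierL2 g ξ)) := by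
  have h1 : ∫ x, (∫ y, f (x - y) ∂μ) * g x = ∫ y, (∫ x, f (x - y) * g x) ∂μ := by
    simp_rw [← integral_mul_const]
    exact integral_integral_swap (integrable_prod_translate_mul μ hfc hgc hf hg)
  rw [h1, ← integral_complex_ofReal]
  simp_rw [integral_translate_mul hf hg]
  rw [integral_integral_swap]
  · refine integral_congr_ae (Eventually.of_forall fun ξ => ?_)
    simp only [mul_assoc (phase _ _)]
    rw [integral_mul_const]
    rfl
  · have h2 : Integrable (fun p : ℝ × ℝ => fourierL2 f p.2 * (starRingEnd ℂ) (fourierL2 g p.2))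
        (μ.prod volume) := (integrable_fourierL2_mul_conj f g).comp_snd μ
    refine Integrable.mono h2 ?_ (Eventually.of_forall fun p => ?_)
    · simp only [Function.uncurry_def, mul_assoc]
      exact continuous_phase.aestronglyMeasurable.mul h2.1
    · simp [Function.uncurry_def, norm_phase]

/-! ### The bilinear form of a signed measure -/

instance isFiniteMeasure_jordanPos (W : SignedMeasure ℝ) : IsFiniteMeasure (jordanPos W) :=
  W.toJordanDecomposition.posPart_finite

instance isFiniteMeasure_jordanNeg (W : SignedMeasure ℝ) : IsFiniteMeasure (jordanNeg W) :=
  W.toJordanDecomposition.negPart_finite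

/-- The bilinear form `∫ (W * f) g`. -/
def nonlocalForm (W : SignedMeasure ℝ) (f g : ℝ → ℝ) : ℝ := ∫ x, conv W f x * g x

/-- Bounded continuous square integrable functions. -/
structure IsBCL2 (f : ℝ → ℝ) : Prop where
  continuous : Continuous f
  memLp : MemLp f 2 volume
  bounded : ∃ C, ∀ x, |f x| ≤ C

theorem IsBCL2.integrable_translate {f : ℝ → ℝ} (hf : Continuous f) (hb : ∃ C, ∀ x, |f x| ≤ C)
    (μ : Measure ℝ) [IsFiniteMeasure μ] (x : ℝ) : Integrable (fun y => f (x - y)) μ := by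
  obtain ⟨C, hC⟩ := hb
  exact Integrable.mono' (integrable_const C) (Continuous.aestronglyMeasurable (by fun_prop))
    (Eventually.of_forall fun y => hC _)

theorem conv_add (W : SignedMeasure ℝ) {f g : ℝ → ℝ} (hf : Continuous f) (hfb : ∃ C, ∀ x, |f x| ≤ C)
    (hg : Continuous g) (hgb : ∃ C, ∀ x, |g x| ≤ C) (x : ℝ) :
    conv W (fun x => f x + g x) x = conv W f x + conv W g x := by
  simp only [conv]
  rw [integral_add (IsBCL2.integrable_translate hf hfb _ _) (IsBCL2.integrable_translate hg hgb _ _),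
    integral_add (IsBCL2.integrable_translate hf hfb _ _) (IsBCL2.integrable_translate hg hgb _ _)]
  ring

theorem conv_const_mul (W : SignedMeasure ℝ) (f : ℝ → ℝ) (c x : ℝ) :
    conv W (fun x => c * f x) x = c * conv W f x := by
  simp only [conv, integral_const_mul]
  ring

theorem integrable_conv_mul (W : SignedMeasure ℝ) {f g : ℝ → ℝ} (hf : IsBCL2 f) (hg : IsBCL2 g) :
    Integrable (fun x => conv W f x * g x) volume := by
  simp only [conv, sub_mul]
  exact (integrable_convMeasure_mul _ hf.1 hg.1 hf.2 hg.2).sub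
    (integrable_convMeasure_mul _ hf.1 hg.1 hf.2 hg.2)

theorem IsBCL2.add {f g : ℝ → ℝ} (hf : IsBCL2 f) (hg : IsBCL2 g) : IsBCL2 fun x => f x + g x := by
  obtain ⟨C, hC⟩ := hf.3
  obtain ⟨D, hD⟩ := hg.3
  exact ⟨hf.1.add hg.1, hf.2.add hg.2, C + D, fun x => (abs_add_le _ _).trans (add_le_add (hC x) (hD x))⟩

theorem IsBCL2.const_mul {f : ℝ → ℝ} (hf : IsBCL2 f) (c : ℝ) : IsBCL2 fun x => c * f x := by
  obtain ⟨C, hC⟩ := hf.3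
  exact ⟨hf.1.const_mul c, hf.2.const_mul c, |c| * C, fun x => by rw [abs_mul]; gcongr; exact hC x⟩

/-- Expansion of the quadratic form along a line. -/
theorem nonlocalForm_add_mul (W : SignedMeasure ℝ) {f g : ℝ → ℝ} (hf : IsBCL2 f) (hg : IsBCL2 g)
    (t : ℝ) : nonlocalForm W (fun x => f x + t * g x) (fun x => f x + t * g x) =
      nonlocalForm W f f + t * (nonlocalForm W f g + nonlocalForm W g f) +
        t ^ 2 * nonlocalForm W g g := by
  have hg' := hg.const_mul t
  simp only [nonlocalForm]
  have : ∀ x, conv W (fun x => f x + t * g x) x * (f x + t * g x) =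
      (conv W f x * f x + t * (conv W f x * g x + conv W g x * f x)) +
        t ^ 2 * (conv W g x * g x) := fun x => by
    rw [conv_add W hf.1 hf.3 hg'.1 hg'.3, conv_const_mul]; ring
  simp only [this]
  rw [integral_add, integral_add, integral_const_mul, integral_const_mul, integral_add]
  · exact integrable_conv_mul W hf hg
  · exact integrable_conv_mul W hg hf
  · exact integrable_conv_mul W hf hf
  · exact ((integrable_conv_mul W hf hg).add (integrable_conv_mul W hg hf)).const_mul t
  · exact (integrable_conv_mul W hf hf).add
      (((integrable_conv_mul W hf hg).add (integrable_conv_mul W hg hf)).const_mul t)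
  · exact (integrable_conv_mul W hg hg).const_mul _

theorem continuous_fourierSigned (W : SignedMeasure ℝ) :
    Continuous fun ξ => fourierSigned W (2 * Real.pi * ξ) :=
  (continuous_fourierMeasure _).sub (continuous_fourierMeasure _)

theorem norm_fourierSigned_le (W : SignedMeasure ℝ) (ξ : ℝ) :
    ‖fourierSigned W (2 * Real.pi * ξ)‖ ≤ (jordanPos W).real univ + (jordanNeg W).real univ :=
  (norm_sub_le _ _).trans (add_le_add (norm_fourierMeasure_le _ _) (norm_fourierMeasure_le _ _))

theorem integrable_fourierSigned_mul (W : SignedMeasure ℝ) {G : ℝ → ℂ} (hG : Integrable G) :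
    Integrable (fun ξ => fourierSigned W (2 * Real.pi * ξ) * G ξ) :=
  hG.bdd_mul (continuous_fourierSigned W).aestronglyMeasurable
    (Eventually.of_forall (norm_fourierSigned_le W))

theorem nonlocalForm_eq (W : SignedMeasure ℝ) {f g : ℝ → ℝ} (hf : IsBCL2 f) (hg : IsBCL2 g) :
    (nonlocalForm W f g : ℂ) = ∫ ξ, fourierSigned W (2 * Real.pi * ξ) *
      (fourierL2 f ξ * (starRingEnd ℂ) (fourierL2 g ξ)) := by
  have hG := integrable_fourierL2_mul_conj f g
  simp only [nonlocalForm, conv, sub_mul, fourierSigned]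
  rw [integral_sub (integrable_convMeasure_mul _ hf.1 hg.1 hf.2 hg.2)
    (integrable_convMeasure_mul _ hf.1 hg.1 hf.2 hg.2), Complex.ofReal_sub,
    integral_convMeasure_mul _ hf.1 hg.1 hf.2 hg.2,
    integral_convMeasure_mul _ hf.1 hg.1 hf.2 hg.2, integral_sub]
  · exact hG.bdd_mul (continuous_fourierMeasure _).aestronglyMeasurable
      (Eventually.of_forall (norm_fourierMeasure_le _))
  · exact hG.bdd_mul (continuous_fourierMeasure _).aestronglyMeasurable
      (Eventually.of_forall (norm_fourierMeasure_le _))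

theorem integrable_re_fourierSigned_mul (W : SignedMeasure ℝ) (f : ℝ → ℝ) :
    Integrable fun ξ => (fourierSigned W (2 * Real.pi * ξ)).re * ‖fourierL2 f ξ‖ ^ 2 := by
  have h := (integrable_fourierSigned_mul W (integrable_fourierL2_mul_conj f f)).re
  refine h.congr (Eventually.of_forall fun ξ => ?_)
  simp only [Complex.mul_conj', RCLike.re_to_complex]
  rw [← Complex.ofReal_pow, Complex.re_mul_ofReal]

theorem nonlocalForm_self_eq (W : SignedMeasure ℝ) {f : ℝ → ℝ} (hf : IsBCL2 f) :
    nonlocalForm W f f =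
      ∫ ξ, (fourierSigned W (2 * Real.pi * ξ)).re * ‖fourierL2 f ξ‖ ^ 2 := by
  have h := congrArg Complex.re (nonlocalForm_eq W hf hf)
  rw [Complex.ofReal_re] at h
  rw [h, ← RCLike.re_to_complex,
    ← integral_re (integrable_fourierSigned_mul W (integrable_fourierL2_mul_conj f f))]
  refine integral_congr_ae (Eventually.of_forall fun ξ => ?_)
  simp only [Complex.mul_conj', RCLike.re_to_complex]
  rw [← Complex.ofReal_pow, Complex.re_mul_ofReal]

theorem ae_two_pi_mul {p : ℝ → Prop} (h : ∀ᵐ ξ, p ξ) : ∀ᵐ ξ : ℝ, p (2 * Real.pi * ξ) := by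
  rw [ae_iff] at h ⊢
  have := Real.volume_preimage_mul_left (a := 2 * Real.pi) (by positivity) {a | ¬p a}
  rw [h, mul_zero] at this
  exact this

theorem nonlocalForm_self_nonneg {W : SignedMeasure ℝ} {κ : ℝ} (hW : FourierLowerBound W κ)
    {f : ℝ → ℝ} (hf : IsBCL2 f) : 0 ≤ nonlocalForm W f f := by
  rw [nonlocalForm_self_eq W hf]
  refine integral_nonneg_of_ae ?_
  filter_upwards [ae_two_pi_mul hW] with ξ hξ
  exact mul_nonneg ((le_max_right _ _).trans hξ) (sq_nonneg _)

theorem nonlocalForm_self_le (W : SignedMeasure ℝ) {f : ℝ → ℝ} (hf : IsBCL2 f) :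
    nonlocalForm W f f ≤ ((jordanPos W).real univ + (jordanNeg W).real univ) * ∫ x, f x ^ 2 := by
  rw [nonlocalForm_self_eq W hf, ← integral_norm_fourierL2_sq hf.2, ← integral_const_mul]
  refine integral_mono (integrable_re_fourierSigned_mul W f)
    ((integrable_norm_fourierL2_sq f).const_mul _) fun ξ => ?_
  refine mul_le_mul_of_nonneg_right ?_ (sq_nonneg _)
  exact (Complex.re_le_norm _).trans (norm_fourierSigned_le W ξ)

/-- The L² product is the form of the Dirac mass at 0, whose symbol is 1; the difference of the two
forms therefore has symbol Ŵ - 1. -/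
theorem abs_nonlocalForm_sub_le_integral (W : SignedMeasure ℝ) {f g : ℝ → ℝ} (hf : IsBCL2 f)
    (hg : IsBCL2 g) : |nonlocalForm W f g - ∫ x, f x * g x| ≤
      ∫ ξ, ‖fourierSigned W (2 * Real.pi * ξ) - 1‖ * (‖fourierL2 f ξ‖ * ‖fourierL2 g ξ‖) := by
  have h1 : ((nonlocalForm W f g - ∫ x, f x * g x : ℝ) : ℂ) =
      ∫ ξ, (fourierSigned W (2 * Real.pi * ξ) - 1) *
        (fourierL2 f ξ * (starRingEnd ℂ) (fourierL2 g ξ)) := by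
    have h2 := integral_translate_mul hf.2 hg.2 0
    simp only [sub_zero, mul_assoc (phase _ _)] at h2
    have h3 : ∀ ξ, phase 0 ξ = 1 := by simp [phase]
    simp only [h3, one_mul] at h2
    rw [Complex.ofReal_sub, nonlocalForm_eq W hf hg, h2, ← integral_sub]
    · simp only [sub_mul, one_mul]
    · exact integrable_fourierSigned_mul W (integrable_fourierL2_mul_conj f g)
    · exact integrable_fourierL2_mul_conj f g
  rw [← Real.norm_eq_abs, ← Complex.norm_real, h1]
  refine (norm_integral_le_integral_norm _).trans_eq ?_
  simp

theorem memLp_fourierSigned_sub_one_mul (W : SignedMeasure ℝ) (g : ℝ → ℝ) :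
    MemLp (fun ξ => ‖fourierSigned W (2 * Real.pi * ξ) - 1‖ * ‖fourierL2 g ξ‖) 2 volume := by
  refine MemLp.of_le_mul (c := (jordanPos W).real univ + (jordanNeg W).real univ + 1)
    (memLp_fourierL2 g) ?_ (Eventually.of_forall fun ξ => ?_)
  · exact ((continuous_fourierSigned W).sub continuous_const).norm.aestronglyMeasurable.mul
      (memLp_fourierL2 g).1.norm
  · rw [norm_mul, norm_norm, norm_norm]
    gcongr
    refine (norm_sub_le _ _).trans ?_
    rw [norm_one]
    gcongr
    exact norm_fourierSigned_le W ξ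

/-- The distance between the nonlocal form and the `L²` product. -/
theorem abs_nonlocalForm_sub_le (W : SignedMeasure ℝ) {f g : ℝ → ℝ} (hf : IsBCL2 f)
    (hg : IsBCL2 g) : |nonlocalForm W f g - ∫ x, f x * g x| ≤ √(∫ x, f x ^ 2) *
      √(∫ ξ, (‖fourierSigned W (2 * Real.pi * ξ) - 1‖ * ‖fourierL2 g ξ‖) ^ 2) := by
  refine (abs_nonlocalForm_sub_le_integral W hf hg).trans ?_
  have h := abs_integral_mul_le (memLp_fourierL2 f).norm (memLp_fourierSigned_sub_one_mul W g)
  rw [integral_norm_fourierL2_sq hf.2] at h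
  refine (le_abs_self _).trans (le_trans (le_of_eq ?_) h)
  congr 2; ext ξ; ring

/-- Expanding the quadratic form along a line produces the mixed terms in both orders, so the
estimate is needed with the arguments exchanged. -/
theorem abs_nonlocalForm_sub_le' (W : SignedMeasure ℝ) {f g : ℝ → ℝ} (hf : IsBCL2 f)
    (hg : IsBCL2 g) : |nonlocalForm W g f - ∫ x, f x * g x| ≤ √(∫ x, f x ^ 2) *
      √(∫ ξ, (‖fourierSigned W (2 * Real.pi * ξ) - 1‖ * ‖fourierL2 g ξ‖) ^ 2) := by
  have h0 : ∫ x, f x * g x = ∫ x, g x * f x := by simp only [mul_comm]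
  rw [h0]
  refine (abs_nonlocalForm_sub_le_integral W hg hf).trans ?_
  have h := abs_integral_mul_le (memLp_fourierL2 f).norm (memLp_fourierSigned_sub_one_mul W g)
  rw [integral_norm_fourierL2_sq hf.2] at h
  refine (le_abs_self _).trans (le_trans (le_of_eq ?_) h)
  congr 2; ext ξ; ring

/-! ### The lower bound of the form by the `H¹` norm -/

/-- The increment is the integral of `f'` over an interval of length t: Cauchy–Schwarz yields one
factor t and Fubini the other. -/
theorem integral_translate_sub_sq_le {f f' : ℝ → ℝ} (hfd : ∀ x, HasDerivAt f (f' x) x)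
    (hf'c : Continuous f') (hf : MemLp f 2 volume) (hf' : MemLp f' 2 volume) {t : ℝ} (ht : 0 < t) :
    ∫ x, (f (x - t) - f x) ^ 2 ≤ t ^ 2 * ∫ x, f' x ^ 2 := by
  set μ : Measure ℝ := volume.restrict (Ioc 0 t) with hμ
  have hμt : μ.real univ = t := by simp [hμ, ht.le]
  have hI : Integrable (fun p : ℝ × ℝ => f' (p.1 - p.2) ^ 2) (volume.prod μ) := by
    have hm : AEStronglyMeasurable (fun p : ℝ × ℝ => f' (p.1 - p.2) ^ 2) (volume.prod μ) :=
      Continuous.aestronglyMeasurable (by fun_prop)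
    rw [integrable_prod_iff' hm]
    refine ⟨Eventually.of_forall fun y => (MemLp.translate hf' y).integrable_sq, ?_⟩
    have : ∀ y : ℝ, ∫ x, ‖f' (x - y) ^ 2‖ = ∫ x, f' x ^ 2 := fun y => by
      simp only [norm_pow, Real.norm_eq_abs, sq_abs]
      exact integral_sub_right_eq_self (fun x => f' x ^ 2) y
    simp only [this]
    exact integrable_const _
  have hpt : ∀ x, (f (x - t) - f x) ^ 2 ≤ t * ∫ y, f' (x - y) ^ 2 ∂μ := fun x => by
    have h1 : f x - f (x - t) = ∫ y, f' (x - y) ∂μ := by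
      rw [hμ, ← intervalIntegral.integral_of_le ht.le,
        intervalIntegral.integral_comp_sub_left (fun y => f' y) x, sub_zero,
        intervalIntegral.integral_eq_sub_of_hasDerivAt (fun y _ => hfd y)
          (hf'c.intervalIntegrable _ _)]
    have hL : MemLp (fun y => f' (x - y)) 2 μ :=
      (hf'.comp_measurePreserving (Measure.measurePreserving_sub_left volume x)).mono_measure
        Measure.restrict_le_self
    have h2 := abs_integral_mul_le (memLp_const (1 : ℝ) (μ := μ)) hL
    simp only [one_mul, one_pow, integral_const, hμt, smul_eq_mul, mul_one] at h2
    rw [← neg_sq, neg_sub, h1, ← sq_abs]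
    calc _ ≤ (√t * √(∫ y, f' (x - y) ^ 2 ∂μ)) ^ 2 := by gcongr
      _ = _ := by
        rw [mul_pow, Real.sq_sqrt ht.le, Real.sq_sqrt (integral_nonneg fun x => sq_nonneg _)]
  calc _ ≤ ∫ x, t * ∫ y, f' (x - y) ^ 2 ∂μ := by
        refine integral_mono ((MemLp.translate hf t).sub hf).integrable_sq
          (hI.integral_prod_left.const_mul t) hpt
    _ = t ^ 2 * ∫ x, f' x ^ 2 := by
      rw [integral_const_mul, integral_integral_swap hI]
      simp only [integral_sub_right_eq_self (fun x => f' x ^ 2), integral_const, hμt, smul_eq_mul]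
      ring

theorem integral_translate_sub_sq {f : ℝ → ℝ} (hf : MemLp f 2 volume) (t : ℝ) :
    ∫ x, (f (x - t) - f x) ^ 2 = ∫ ξ, 2 * (1 - (phase t ξ).re) * ‖fourierL2 f ξ‖ ^ 2 := by
  have h1 : ∫ x, (f (x - t) - f x) ^ 2 = 2 * (∫ x, f x ^ 2) - 2 * ∫ x, f (x - t) * f x := by
    have : ∀ x, (f (x - t) - f x) ^ 2 = (f (x - t) ^ 2 + f x ^ 2) - 2 * (f (x - t) * f x) :=
      fun x => by ring
    simp only [this]
    rw [integral_sub, integral_add, integral_const_mul,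
      integral_sub_right_eq_self (fun x => f x ^ 2)]
    · ring
    · exact (MemLp.translate hf t).integrable_sq
    · exact hf.integrable_sq
    · exact (MemLp.translate hf t).integrable_sq.add hf.integrable_sq
    · exact (MemLp.integrable_mul_two (MemLp.translate hf t) hf).const_mul 2
  have hI : Integrable fun ξ => phase t ξ * ((‖fourierL2 f ξ‖ ^ 2 : ℝ) : ℂ) :=
    (integrable_norm_fourierL2_sq f).ofReal.bdd_mul
      (continuous_phase_right t).aestronglyMeasurable
      (Eventually.of_forall fun ξ => (norm_phase t ξ).le)
  have h2 : ∫ x, f (x - t) * f x = ∫ ξ, (phase t ξ).re * ‖fourierL2 f ξ‖ ^ 2 := by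
    have h := congrArg Complex.re (integral_translate_mul hf hf t)
    simp only [mul_assoc, Complex.mul_conj', ← Complex.ofReal_pow] at h
    rw [Complex.ofReal_re] at h
    rw [h, ← RCLike.re_to_complex, ← integral_re hI]
    simp only [RCLike.re_to_complex, Complex.re_mul_ofReal]
  have hI2 : Integrable fun ξ => (phase t ξ).re * ‖fourierL2 f ξ‖ ^ 2 := by
    simpa only [RCLike.re_to_complex, Complex.re_mul_ofReal] using hI.re
  rw [h1, h2, ← integral_norm_fourierL2_sq hf, ← mul_sub, ← integral_sub
    (integrable_norm_fourierL2_sq f) hI2, ← integral_const_mul]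
  congr 1; ext ξ; ring

/-- This is 2(1 - cos θ) = 4 sin²(θ/2), written with the cardinal sine so that division by t² leaves
an expression continuous at t = 0. -/
theorem two_mul_one_sub_re_phase (t ξ : ℝ) :
    2 * (1 - (phase t ξ).re) = (t * (2 * Real.pi * ξ) * Real.sinc (t * Real.pi * ξ)) ^ 2 := by
  have h1 : (phase t ξ).re = Real.cos (2 * (t * Real.pi * ξ)) := by
    have : -(Complex.I * t * (2 * Real.pi * ξ : ℝ)) =
        ((-(2 * (t * Real.pi * ξ)) : ℝ) : ℂ) * Complex.I := by
      push_cast; ring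
    rw [phase, this, Complex.exp_ofReal_mul_I_re, Real.cos_neg]
  have h2 : (t * Real.pi * ξ) * Real.sinc (t * Real.pi * ξ) = Real.sin (t * Real.pi * ξ) := by
    rcases eq_or_ne (t * Real.pi * ξ) 0 with h | h
    · simp [h]
    · rw [Real.sinc_of_ne_zero h, mul_div_cancel₀ _ h]
  rw [h1, Real.cos_two_mul, Real.cos_sq', ← h2]
  ring

/-- The quantitative coercivity coming from `Ŵ(ξ) ≥ (1 - κξ²)⁺`. -/
theorem integral_sq_le_nonlocalForm_add {W : SignedMeasure ℝ} {κ : ℝ} (hκ : 0 ≤ κ)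
    (hW : FourierLowerBound W κ) {f f' : ℝ → ℝ} (hf : IsBCL2 f)
    (hfd : ∀ x, HasDerivAt f (f' x) x) (hf'c : Continuous f') (hf' : MemLp f' 2 volume) :
    ∫ x, f x ^ 2 ≤ nonlocalForm W f f + κ * ∫ x, f' x ^ 2 := by
  -- The symbol (1 - κ(2πξ)²)⁺ with differentiation replaced by a difference quotient of step t; it
  -- is recovered at t = 0. The truncation at 0 makes ‖f̂‖² a dominating function as t → 0⁺, so the
  -- Fourier transform of `f'` is never needed.
  let m : ℝ → ℝ → ℝ := fun t ξ =>
    max (1 - κ * ((2 * Real.pi * ξ) * Real.sinc (t * Real.pi * ξ)) ^ 2) 0 * ‖fourierL2 f ξ‖ ^ 2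
  have hF := integrable_norm_fourierL2_sq f
  have hmeas : ∀ t, AEStronglyMeasurable (m t) volume := fun t =>
    (Continuous.aestronglyMeasurable (by fun_prop)).mul hF.1
  have hbd : ∀ t ξ, ‖m t ξ‖ ≤ ‖fourierL2 f ξ‖ ^ 2 := fun t ξ => by
    rw [Real.norm_of_nonneg (by positivity)]
    refine mul_le_of_le_one_left (by positivity) (max_le ?_ zero_le_one)
    have : 0 ≤ κ * ((2 * Real.pi * ξ) * Real.sinc (t * Real.pi * ξ)) ^ 2 := by positivity
    linarith
  have hlim : Tendsto (fun t => ∫ ξ, m t ξ) (𝓝[>] 0) (𝓝 (∫ ξ, m 0 ξ)) := by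
    refine tendsto_integral_filter_of_dominated_convergence (fun ξ => ‖fourierL2 f ξ‖ ^ 2)
      (Eventually.of_forall hmeas) (Eventually.of_forall fun t => Eventually.of_forall (hbd t)) hF
      (Eventually.of_forall fun ξ => ?_)
    have : Continuous fun t => m t ξ := by fun_prop
    exact (this.tendsto 0).mono_left nhdsWithin_le_nhds
  have hlow : ∀ᶠ t in 𝓝[>] (0 : ℝ), (∫ x, f x ^ 2) - κ * (∫ x, f' x ^ 2) ≤ ∫ ξ, m t ξ := by
    filter_upwards [self_mem_nhdsWithin] with t (ht : 0 < t)
    have h1 := integral_translate_sub_sq_le hfd hf'c hf.2 hf' ht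
    rw [integral_translate_sub_sq hf.2 t] at h1
    simp only [two_mul_one_sub_re_phase] at h1
    have h2 : ∀ ξ, (t * (2 * Real.pi * ξ) * Real.sinc (t * Real.pi * ξ)) ^ 2 * ‖fourierL2 f ξ‖ ^ 2
        = t ^ 2 * (((2 * Real.pi * ξ) * Real.sinc (t * Real.pi * ξ)) ^ 2 * ‖fourierL2 f ξ‖ ^ 2) :=
      fun ξ => by ring
    simp only [h2] at h1
    rw [integral_const_mul] at h1
    have h3 := le_of_mul_le_mul_left h1 (by positivity)
    have hI : Integrable fun ξ => ((2 * Real.pi * ξ) * Real.sinc (t * Real.pi * ξ)) ^ 2 *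
        ‖fourierL2 f ξ‖ ^ 2 := by
      have hc : Continuous fun ξ => ((2 * Real.pi * ξ) * Real.sinc (t * Real.pi * ξ)) ^ 2 := by
        fun_prop
      -- For fixed t the squared factor is 2(1 - Re phase)/t², and a phase has modulus 1.
      refine hF.bdd_mul (c := 4 / t ^ 2) hc.aestronglyMeasurable (Eventually.of_forall fun ξ => ?_)
      rw [Real.norm_of_nonneg (by positivity), le_div_iff₀ (by positivity)]
      have h4 := two_mul_one_sub_re_phase t ξ
      have h5 := (abs_le.1 (Complex.abs_re_le_norm (phase t ξ))).1
      rw [norm_phase] at h5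
      nlinarith
    calc _ ≤ (∫ ξ, ‖fourierL2 f ξ‖ ^ 2) - κ * ∫ ξ, ((2 * Real.pi * ξ) *
          Real.sinc (t * Real.pi * ξ)) ^ 2 * ‖fourierL2 f ξ‖ ^ 2 := by
          rw [integral_norm_fourierL2_sq hf.2]; gcongr
      _ = ∫ ξ, (‖fourierL2 f ξ‖ ^ 2 - κ * (((2 * Real.pi * ξ) *
          Real.sinc (t * Real.pi * ξ)) ^ 2 * ‖fourierL2 f ξ‖ ^ 2)) := by
          rw [integral_sub hF (hI.const_mul κ), integral_const_mul]
      _ ≤ _ := by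
        refine integral_mono (hF.sub (hI.const_mul κ))
          (Integrable.mono' hF (hmeas t) (Eventually.of_forall (hbd t))) fun ξ => ?_
        have : (1 - κ * ((2 * Real.pi * ξ) * Real.sinc (t * Real.pi * ξ)) ^ 2) *
          ‖fourierL2 f ξ‖ ^ 2 ≤ m t ξ := mul_le_mul_of_nonneg_right (le_max_left _ _) (sq_nonneg _)
        refine le_trans (le_of_eq ?_) this
        ring
  have h6 := ge_of_tendsto hlim hlow
  have h7 : ∫ ξ, m 0 ξ ≤ nonlocalForm W f f := by
    rw [nonlocalForm_self_eq W hf]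
    refine integral_mono_ae (Integrable.mono' hF (hmeas 0) (Eventually.of_forall (hbd 0)))
      (integrable_re_fourierSigned_mul W f) ?_
    filter_upwards [ae_two_pi_mul hW] with ξ hξ
    refine mul_le_mul_of_nonneg_right ?_ (sq_nonneg _)
    simpa using hξ
  linarith

theorem real_univ_add_le {W : SignedMeasure ℝ} {M : NNReal} (h : tvNorm W ≤ M) :
    (jordanPos W).real univ + (jordanNeg W).real univ ≤ M := by
  rw [Measure.real, Measure.real, ← ENNReal.toReal_add (measure_ne_top _ _) (measure_ne_top _ _)]
  exact ENNReal.toReal_le_of_le_ofReal M.2 (by simpa [tvNorm] using h)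

/-- If `Ŵ_λ → 1` boundedly, then the distance between the nonlocal form of `W_λ` and the `L²`
product, tested against a fixed function, tends to zero. -/
theorem tendsto_fourierSigned_sub_one {ι : Type*} {l : Filter ι} [l.IsCountablyGenerated]
    {W : ι → SignedMeasure ℝ} {α : ℝ} (hconv : ∀ᵐ ξ : ℝ,
      Tendsto (fun i => fourierMeasure (jordanPos (W i)) ξ) l (𝓝 ((1 + α : ℝ) : ℂ)) ∧
      Tendsto (fun i => fourierMeasure (jordanNeg (W i)) ξ) l (𝓝 (α : ℂ)))
    {M : NNReal} (hM : ∀ᶠ i in l, tvNorm (W i) ≤ M) (g : ℝ → ℝ) :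
    Tendsto (fun i => √(∫ ξ, (‖fourierSigned (W i) (2 * Real.pi * ξ) - 1‖ * ‖fourierL2 g ξ‖) ^ 2))
      l (𝓝 0) := by
  rw [← Real.sqrt_zero]
  refine (Real.continuous_sqrt.tendsto 0).comp ?_
  have h0 : (0 : ℝ) = ∫ _ : ℝ, (0 : ℝ) := by simp
  rw [h0]
  refine tendsto_integral_filter_of_dominated_convergence
    (fun ξ => (M + 1 : ℝ) ^ 2 * ‖fourierL2 g ξ‖ ^ 2)
    (Eventually.of_forall fun i => (memLp_fourierSigned_sub_one_mul (W i) g).integrable_sq.1) ?_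
    ((integrable_norm_fourierL2_sq g).const_mul _) ?_
  · filter_upwards [hM] with i hi
    refine Eventually.of_forall fun ξ => ?_
    rw [Real.norm_of_nonneg (by positivity), mul_pow]
    gcongr
    refine (norm_sub_le _ _).trans ?_
    rw [norm_one]
    gcongr
    exact (norm_fourierSigned_le _ _).trans (real_univ_add_le hi)
  · filter_upwards [ae_two_pi_mul hconv] with ξ hξ
    have h1 := ((((hξ.1.sub hξ.2).sub_const 1).norm.mul_const ‖fourierL2 g ξ‖).pow 2)
    have h2 : (‖((1 + α : ℝ) : ℂ) - (α : ℂ) - 1‖ * ‖fourierL2 g ξ‖) ^ 2 = 0 := by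
      push_cast; simp
    rw [h2] at h1
    exact h1

/-! ### Weak derivatives -/

theorem IsTestFunction.integrable {φ : ℝ → ℝ} (h : IsTestFunction φ) : Integrable φ volume :=
  h.1.continuous.integrable_of_hasCompactSupport h.2

theorem integrable_mul_test {v φ : ℝ → ℝ} (hv : LocallyIntegrable v volume)
    (h : Continuous φ) (h' : HasCompactSupport φ) : Integrable (fun x => v x * φ x) volume := by
  simpa [mul_comm] using hv.integrable_smul_left_of_hasCompactSupport h h'

theorem IsTestFunction.deriv {φ : ℝ → ℝ} (h : IsTestFunction φ) : IsTestFunction (deriv φ) :=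
  ⟨(contDiff_infty_iff_deriv.1 h.1).2, h.2.deriv⟩

/-- A test function with integral zero is the derivative of a test function. -/
theorem IsTestFunction.exists_primitive {k : ℝ → ℝ} (hk : IsTestFunction k)
    (h0 : ∫ x, k x = 0) : ∃ φ, IsTestFunction φ ∧ _root_.deriv φ = k := by
  obtain ⟨R, hR⟩ := hk.2.isBounded.subset_closedBall 0
  rw [Real.closedBall_eq_Icc, zero_sub, zero_add] at hR
  have hout : ∀ x, x ∉ Icc (-R) R → k x = 0 := fun x hx =>
    image_eq_zero_of_notMem_tsupport fun h => hx (hR h)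
  have hd : ∀ x, HasDerivAt (fun x => ∫ t in (-R)..x, k t) (k x) x := fun x =>
    intervalIntegral.integral_hasDerivAt_right (hk.1.continuous.intervalIntegrable _ _)
      hk.1.continuous.stronglyMeasurable.stronglyMeasurableAtFilter hk.1.continuous.continuousAt
  have hd' : _root_.deriv (fun x => ∫ t in (-R)..x, k t) = k := funext fun x => (hd x).deriv
  refine ⟨fun x => ∫ t in (-R)..x, k t, ⟨?_, ?_⟩, hd'⟩
  · rw [contDiff_infty_iff_deriv, hd']
    exact ⟨fun x => (hd x).differentiableAt, hk.1⟩
  · refine HasCompactSupport.of_support_subset_isCompact (isCompact_Icc (a := -R) (b := R)) ?_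
    intro x hx
    by_contra hx'
    apply hx
    rcases lt_or_ge x (-R) with h | h
    · show ∫ t in (-R)..x, k t = 0
      rw [intervalIntegral.integral_symm, intervalIntegral.integral_of_le h.le, neg_eq_zero,
        integral_Ioc_eq_integral_Ioo]
      exact setIntegral_eq_zero_of_forall_eq_zero fun t ht => hout t fun h' => by
        linarith [h'.1, ht.2]
    · have hxR : R < x := by
        by_contra h'
        exact hx' ⟨h, not_lt.1 h'⟩
      show ∫ t in (-R)..x, k t = 0
      rw [intervalIntegral.integral_of_le h, ← h0]
      refine setIntegral_eq_integral_of_ae_compl_eq_zero ?_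
      have : ∀ᵐ t : ℝ, t ≠ -R := by simp [ae_iff]
      filter_upwards [this] with t ht ht'
      refine hout t fun h' => ht' ⟨lt_of_le_of_ne h'.1 (Ne.symm ht), h'.2.trans hxR.le⟩

/-- The du Bois-Reymond lemma. Subtracting (∫ ψ) ρ, with ρ a normalized bump, turns any test
function ψ into the derivative of one; testing against it gives ∫ v ψ = c ∫ ψ with c = ∫ v ρ. -/
theorem ae_eq_const_of_weakDeriv_zero {v : ℝ → ℝ} (hv : LocallyIntegrable v volume)
    (h : ∀ φ, IsTestFunction φ → ∫ x, v x * deriv φ x = 0) : ∃ c, ∀ᵐ x, v x = c := by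
  let b : ContDiffBump (0 : ℝ) := ⟨1, 2, zero_lt_one, one_lt_two⟩
  let ρ : ℝ → ℝ := b.normed volume
  have hρ : IsTestFunction ρ := ⟨b.contDiff_normed, b.hasCompactSupport_normed⟩
  have hρ1 : ∫ x, ρ x = 1 := b.integral_normed
  refine ⟨∫ x, v x * ρ x, ?_⟩
  refine ae_eq_of_integral_contDiff_smul_eq hv (locallyIntegrable_const _) fun ψ hψ hψ' => ?_
  have hψt : IsTestFunction ψ := ⟨hψ, hψ'⟩
  obtain ⟨φ, hφ, hφd⟩ := IsTestFunction.exists_primitive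
    (k := fun x => ψ x - (∫ y, ψ y) * ρ x)
    ⟨hψ.sub (contDiff_const.mul hρ.1), hψ'.sub (hρ.2.mul_left)⟩ (by
      rw [integral_sub hψt.integrable (hρ.integrable.const_mul _), integral_const_mul, hρ1]; ring)
  have h1 := h φ hφ
  rw [hφd] at h1
  have h2 : ∀ x, v x * (ψ x - (∫ y, ψ y) * ρ x) = v x * ψ x - (∫ y, ψ y) * (v x * ρ x) :=
    fun x => by ring
  simp only [h2] at h1
  rw [integral_sub (integrable_mul_test hv hψ.continuous hψ')
    ((integrable_mul_test hv hρ.1.continuous hρ.2).const_mul _), integral_const_mul] at h1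
  simp only [smul_eq_mul, integral_mul_const]
  simp only [mul_comm (ψ _)]
  linarith

theorem hasWeakDeriv_of_hasDerivAt {f f' : ℝ → ℝ} (h : ∀ x, HasDerivAt f (f' x) x)
    (hf' : Continuous f') : HasWeakDeriv f f' := by
  have hf : Continuous f := continuous_iff_continuousAt.2 fun x => (h x).continuousAt
  refine ⟨hf.locallyIntegrable, hf'.locallyIntegrable, fun φ hφ => ?_⟩
  have hφd : ∀ x, HasDerivAt φ (deriv φ x) x := fun x =>
    ((hφ.1.differentiable (by simp)) x).hasDerivAt
  refine integral_mul_deriv_eq_deriv_mul_of_integrable (fun x _ => h x) (fun x _ => hφd x) ?_ ?_ ?_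
  · exact integrable_mul_test hf.locallyIntegrable hφ.deriv.1.continuous hφ.deriv.2
  · exact integrable_mul_test hf'.locallyIntegrable hφ.1.continuous hφ.2
  · exact integrable_mul_test hf.locallyIntegrable hφ.1.continuous hφ.2

theorem HasWeakDeriv.unique {f g₁ g₂ : ℝ → ℝ} (h₁ : HasWeakDeriv f g₁) (h₂ : HasWeakDeriv f g₂) :
    g₁ =ᵐ[volume] g₂ := by
  refine ae_eq_of_integral_contDiff_smul_eq h₁.2.1 h₂.2.1 fun ψ hψ hψ' => ?_
  have := (h₁.2.2 ψ ⟨hψ, hψ'⟩).symm.trans (h₂.2.2 ψ ⟨hψ, hψ'⟩)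
  simpa [mul_comm] using this

theorem HasWeakDeriv.weakDeriv {f g : ℝ → ℝ} (h : HasWeakDeriv f g) :
    HasWeakDeriv f (weakDeriv f) := by
  have h' : ∃ g, HasWeakDeriv f g := ⟨g, h⟩
  rw [NonlocalGP.weakDeriv, dif_pos h']
  exact h'.choose_spec

theorem weakDeriv_ae_eq {f f' : ℝ → ℝ} (h : ∀ x, HasDerivAt f (f' x) x) (hf' : Continuous f') :
    weakDeriv f =ᵐ[volume] f' :=
  (hasWeakDeriv_of_hasDerivAt h hf').weakDeriv.unique (hasWeakDeriv_of_hasDerivAt h hf')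

/-- A function with a continuous weak derivative is a.e. equal to a function of class `C¹`. -/
theorem HasWeakDeriv.exists_hasDerivAt {v g : ℝ → ℝ} (h : HasWeakDeriv v g) (hg : Continuous g) :
    ∃ p : ℝ → ℝ, (∀ x, HasDerivAt p (g x) x) ∧ v =ᵐ[volume] p := by
  have hd : ∀ x, HasDerivAt (fun x => ∫ t in (0 : ℝ)..x, g t) (g x) x := fun x =>
    intervalIntegral.integral_hasDerivAt_right (hg.intervalIntegrable _ _)
      hg.stronglyMeasurable.stronglyMeasurableAtFilter hg.continuousAt
  have hw := hasWeakDeriv_of_hasDerivAt hd hg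
  obtain ⟨c, hc⟩ := ae_eq_const_of_weakDeriv_zero (h.1.sub hw.1) fun φ hφ => by
    simp only [Pi.sub_apply, sub_mul]
    rw [integral_sub (integrable_mul_test h.1 hφ.deriv.1.continuous hφ.deriv.2)
      (integrable_mul_test hw.1 hφ.deriv.1.continuous hφ.deriv.2), h.2.2 φ hφ, hw.2.2 φ hφ, sub_self]
  refine ⟨fun x => (∫ t in (0 : ℝ)..x, g t) + c, fun x => (hd x).add_const c, ?_⟩
  filter_upwards [hc] with x hx
  rw [← hx]; simp

theorem HasWeakDeriv.congr {v g v' g' : ℝ → ℝ} (h : HasWeakDeriv v g) (hv : v =ᵐ[volume] v')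
    (hg : g =ᵐ[volume] g') : HasWeakDeriv v' g' := by
  refine ⟨h.1.congr hv, h.2.1.congr hg, fun φ hφ => ?_⟩
  have h1 : ∫ x, v x * deriv φ x = ∫ x, v' x * deriv φ x :=
    integral_congr_ae (by filter_upwards [hv] with x hx; rw [hx])
  have h2 : ∫ x, g x * φ x = ∫ x, g' x * φ x :=
    integral_congr_ae (by filter_upwards [hg] with x hx; rw [hx])
  rw [← h1, ← h2, h.2.2 φ hφ]

/-! ### Convolution of smooth bounded functions -/

theorem continuous_conv (W : SignedMeasure ℝ) {f : ℝ → ℝ} (hf : Continuous f)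
    (hb : ∃ C, ∀ x, |f x| ≤ C) : Continuous (conv W f) := by
  obtain ⟨C, hC⟩ := hb
  have (μ : Measure ℝ) [IsFiniteMeasure μ] : Continuous fun x => ∫ y, f (x - y) ∂μ := by
    refine continuous_of_dominated (bound := fun _ => C) (fun x => ?_) (fun x => ?_)
      (integrable_const _) ?_
    · exact Continuous.aestronglyMeasurable (by fun_prop)
    · exact Eventually.of_forall fun y => hC _
    · exact Eventually.of_forall fun y => by fun_prop
  exact (this _).sub (this _)

theorem abs_conv_le (W : SignedMeasure ℝ) {f : ℝ → ℝ} {C : ℝ} (hC : ∀ x, |f x| ≤ C) {M : NNReal}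
    (hM : tvNorm W ≤ M) (x : ℝ) : |conv W f x| ≤ M * C := by
  have (μ : Measure ℝ) [IsFiniteMeasure μ] : |∫ y, f (x - y) ∂μ| ≤ C * μ.real univ := by
    rw [← Real.norm_eq_abs]
    exact norm_integral_le_of_norm_le_const (Eventually.of_forall fun y => hC _)
  have hC0 : 0 ≤ C := (abs_nonneg _).trans (hC 0)
  calc _ ≤ C * (jordanPos W).real univ + C * (jordanNeg W).real univ :=
        (abs_sub _ _).trans (add_le_add (this _) (this _))
    _ = ((jordanPos W).real univ + (jordanNeg W).real univ) * C := by ring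
    _ ≤ _ := by gcongr; exact real_univ_add_le hM

theorem hasDerivAt_conv (W : SignedMeasure ℝ) {f f' : ℝ → ℝ} (hf : Continuous f)
    (hb : ∃ C, ∀ x, |f x| ≤ C) (hd : ∀ x, HasDerivAt f (f' x) x) (hf' : Continuous f')
    (hb' : ∃ C, ∀ x, |f' x| ≤ C) (x : ℝ) : HasDerivAt (conv W f) (conv W f' x) x := by
  obtain ⟨C', hC'⟩ := hb'
  have (μ : Measure ℝ) [IsFiniteMeasure μ] :
      HasDerivAt (fun x => ∫ y, f (x - y) ∂μ) (∫ y, f' (x - y) ∂μ) x := by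
    refine (hasDerivAt_integral_of_dominated_loc_of_deriv_le (F := fun x y => f (x - y))
      (F' := fun x y => f' (x - y)) (bound := fun _ => C') (s := univ) univ_mem
      (Eventually.of_forall fun x => Continuous.aestronglyMeasurable (by fun_prop))
      (IsBCL2.integrable_translate hf hb μ x) (Continuous.aestronglyMeasurable (by fun_prop))
      (Eventually.of_forall fun y x _ => hC' _) (integrable_const _)
      (Eventually.of_forall fun y x _ => ?_)).2
    simpa using (hd (x - y)).comp_sub_const x y
  exact (this _).sub (this _)

/-! ### Families of functions with uniformly bounded derivatives -/

/-- All functions of the family are of class `C^n` and their derivatives up to order `n` are bounded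
uniformly on the line and over the family. -/
def UniformlyBddDeriv {ι : Type*} : ℕ → (ι → ℝ → ℝ) → Prop
  | 0, f => (∃ C, ∀ i x, |f i x| ≤ C) ∧ ∀ i, Continuous (f i)
  | n + 1, f => (∃ C, ∀ i x, |f i x| ≤ C) ∧ (∀ i, Differentiable ℝ (f i)) ∧
      UniformlyBddDeriv n fun i => deriv (f i)

namespace UniformlyBddDeriv

variable {ι : Type*} {f g : ι → ℝ → ℝ} {n : ℕ}

theorem bdd (h : UniformlyBddDeriv n f) : ∃ C, ∀ i x, |f i x| ≤ C := by
  cases n <;> exact h.1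

theorem continuous (h : UniformlyBddDeriv n f) (i : ι) : Continuous (f i) := by
  cases n
  · exact h.2 i
  · exact (h.2.1 i).continuous

theorem of_succ (h : UniformlyBddDeriv (n + 1) f) : UniformlyBddDeriv n f := by
  induction n generalizing f with
  | zero => exact ⟨h.1, fun i => (h.2.1 i).continuous⟩
  | succ n ih => exact ⟨h.1, h.2.1, ih h.2.2⟩

theorem contDiff (h : UniformlyBddDeriv n f) (i : ι) : ContDiff ℝ n (f i) := by
  induction n generalizing f with
  | zero => simpa [contDiff_zero] using h.2 i
  | succ n ih =>
    push_cast
    exact contDiff_succ_iff_deriv.2 ⟨h.2.1 i, by simp, ih h.2.2⟩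

theorem const_sub_mul (h : UniformlyBddDeriv n f) (a b : ℝ) :
    UniformlyBddDeriv n fun i x => a - b * f i x := by
  have hb : ∀ {f : ι → ℝ → ℝ} (a : ℝ), (∃ C, ∀ i x, |f i x| ≤ C) →
      ∃ C, ∀ i x, |a - b * f i x| ≤ C := by
    rintro f a ⟨C, hC⟩
    refine ⟨|a| + |b| * C, fun i x => (abs_sub _ _).trans ?_⟩
    rw [abs_mul]
    gcongr
    exact hC i x
  induction n generalizing f a with
  | zero => exact ⟨hb a h.1, fun i => continuous_const.sub (continuous_const.mul (h.2 i))⟩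
  | succ n ih =>
    have hd : ∀ i x, HasDerivAt (fun x => a - b * f i x) (0 - b * deriv (f i) x) x := fun i x =>
      (hasDerivAt_const x a).sub ((h.2.1 i x).hasDerivAt.const_mul b)
    refine ⟨hb a h.1, fun i x => (hd i x).differentiableAt, ?_⟩
    have e : (fun i => deriv fun x => a - b * f i x) = fun i x => 0 - b * deriv (f i) x :=
      funext fun i => funext fun x => (hd i x).deriv
    rw [e]
    exact ih h.2.2 0

theorem add (hf : UniformlyBddDeriv n f) (hg : UniformlyBddDeriv n g) :
    UniformlyBddDeriv n fun i x => f i x + g i x := by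
  have hb : ∀ {f g : ι → ℝ → ℝ}, (∃ C, ∀ i x, |f i x| ≤ C) → (∃ C, ∀ i x, |g i x| ≤ C) →
      ∃ C, ∀ i x, |f i x + g i x| ≤ C := by
    rintro f g ⟨C, hC⟩ ⟨D, hD⟩
    exact ⟨C + D, fun i x => (abs_add_le _ _).trans (add_le_add (hC i x) (hD i x))⟩
  induction n generalizing f g with
  | zero => exact ⟨hb hf.1 hg.1, fun i => (hf.2 i).add (hg.2 i)⟩
  | succ n ih =>
    have hd : ∀ i x, HasDerivAt (fun x => f i x + g i x) (deriv (f i) x + deriv (g i) x) x :=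
      fun i x => (hf.2.1 i x).hasDerivAt.add (hg.2.1 i x).hasDerivAt
    refine ⟨hb hf.1 hg.1, fun i x => (hd i x).differentiableAt, ?_⟩
    have e : (fun i => deriv fun x => f i x + g i x) = fun i x => deriv (f i) x + deriv (g i) x :=
      funext fun i => funext fun x => (hd i x).deriv
    rw [e]
    exact ih hf.2.2 hg.2.2

theorem mul (hf : UniformlyBddDeriv n f) (hg : UniformlyBddDeriv n g) :
    UniformlyBddDeriv n fun i x => f i x * g i x := by
  have hb : ∀ {f g : ι → ℝ → ℝ}, (∃ C, ∀ i x, |f i x| ≤ C) → (∃ C, ∀ i x, |g i x| ≤ C) →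
      ∃ C, ∀ i x, |f i x * g i x| ≤ C := by
    rintro f g ⟨C, hC⟩ ⟨D, hD⟩
    refine ⟨C * D, fun i x => ?_⟩
    rw [abs_mul]
    exact mul_le_mul (hC i x) (hD i x) (abs_nonneg _) ((abs_nonneg _).trans (hC i x))
  induction n generalizing f g with
  | zero => exact ⟨hb hf.1 hg.1, fun i => (hf.2 i).mul (hg.2 i)⟩
  | succ n ih =>
    have hd : ∀ i x, HasDerivAt (fun x => f i x * g i x)
        (deriv (f i) x * g i x + f i x * deriv (g i) x) x :=
      fun i x => (hf.2.1 i x).hasDerivAt.mul (hg.2.1 i x).hasDerivAt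
    refine ⟨hb hf.1 hg.1, fun i x => (hd i x).differentiableAt, ?_⟩
    have e : (fun i => deriv fun x => f i x * g i x) =
        fun i x => deriv (f i) x * g i x + f i x * deriv (g i) x :=
      funext fun i => funext fun x => (hd i x).deriv
    rw [e]
    exact (ih hf.2.2 hg.of_succ).add (ih hf.of_succ hg.2.2)

/-- Derivatives fall on `f`, and integration against a measure of total variation at most `M`
multiplies sup norms by at most `M`. No regularity of the measures is needed. -/
theorem conv {W : ι → SignedMeasure ℝ} {M : NNReal} (hM : ∀ i, tvNorm (W i) ≤ M)
    (hf : UniformlyBddDeriv n f) : UniformlyBddDeriv n fun i => conv (W i) (f i) := by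
  have hb : ∀ {f : ι → ℝ → ℝ}, (∃ C, ∀ i x, |f i x| ≤ C) →
      ∃ C, ∀ i x, |NonlocalGP.conv (W i) (f i) x| ≤ C := by
    rintro f ⟨C, hC⟩
    exact ⟨M * C, fun i x => abs_conv_le (W i) (hC i) (hM i) x⟩
  have hi : ∀ {f : ι → ℝ → ℝ}, (∃ C, ∀ i x, |f i x| ≤ C) → ∀ i, ∃ C, ∀ x, |f i x| ≤ C :=
    fun ⟨C, hC⟩ i => ⟨C, hC i⟩
  induction n generalizing f with
  | zero => exact ⟨hb hf.1, fun i => continuous_conv (W i) (hf.2 i) (hi hf.1 i)⟩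
  | succ n ih =>
    have hd : ∀ i x, HasDerivAt (NonlocalGP.conv (W i) (f i))
        (NonlocalGP.conv (W i) (deriv (f i)) x) x := fun i x =>
      hasDerivAt_conv (W i) (hf.continuous i) (hi hf.1 i) (fun x => (hf.2.1 i x).hasDerivAt)
        (hf.2.2.continuous i) (hi hf.2.2.bdd i) x
    refine ⟨hb hf.1, fun i x => (hd i x).differentiableAt, ?_⟩
    have e : (fun i => deriv (NonlocalGP.conv (W i) (f i))) =
        fun i => NonlocalGP.conv (W i) (deriv (f i)) :=
      funext fun i => funext fun x => (hd i x).deriv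
    rw [e]
    exact ih hf.2.2

end UniformlyBddDeriv

/-- An interpolation inequality for the first derivative. -/
theorem abs_deriv_le_of_abs_le {f f' : ℝ → ℝ} {A B h : ℝ} (hd : ∀ x, HasDerivAt f (f' x) x)
    (hd' : Differentiable ℝ f') (hA : ∀ x, |f x| ≤ A) (hB : ∀ x, |deriv f' x| ≤ B) (hh : 0 < h)
    (x : ℝ) : |f' x| ≤ 2 * A / h + B * h := by
  -- At some c in (x, x + h) the derivative equals the difference quotient, which is at most 2A/h;
  -- moving from c back to x costs at most B h.
  obtain ⟨c, hc, hc'⟩ := exists_hasDerivAt_eq_slope f f' (lt_add_of_pos_right x hh)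
    (fun y _ => (hd y).continuousAt.continuousWithinAt) (fun y _ => hd y)
  have h1 : |f' c - f' x| ≤ B * |c - x| :=
    Convex.norm_image_sub_le_of_norm_deriv_le (fun y _ => hd' y) (fun y _ => hB y)
      convex_univ (mem_univ x) (mem_univ c)
  have h2 : |f' c| ≤ 2 * A / h := by
    rw [hc', add_sub_cancel_left, abs_div, abs_of_pos hh]
    gcongr
    calc _ ≤ |f (x + h)| + |f x| := abs_sub _ _
      _ ≤ 2 * A := by linarith [hA x, hA (x + h)]
  have hB0 : 0 ≤ B := (abs_nonneg _).trans (hB 0)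
  have h3 : |c - x| ≤ h := by rw [abs_of_pos (by linarith [hc.1])]; linarith [hc.2]
  calc |f' x| = |f' c - (f' c - f' x)| := by ring_nf
    _ ≤ |f' c| + |f' c - f' x| := abs_sub _ _
    _ ≤ 2 * A / h + B * h := by
      refine add_le_add h2 (h1.trans ?_)
      gcongr

theorem UniformlyBddDeriv.eventually_deriv {ι : Type*} {l : Filter ι} {f : ι → ℝ → ℝ}
    (hf : UniformlyBddDeriv 2 f) (h0 : ∀ ε > 0, ∀ᶠ i in l, ∀ x, |f i x| ≤ ε) :
    ∀ ε > 0, ∀ᶠ i in l, ∀ x, |deriv (f i) x| ≤ ε := by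
  intro ε hε
  obtain ⟨B, hB⟩ := hf.2.2.2.2.1
  -- This step makes B h ≤ ε/2. Requiring sup |f| ≤ ε h / 4 then makes 2A/h equal to the other ε/2.
  set h : ℝ := ε / (2 * (|B| + 1)) with hh
  have hpos : 0 < h := by positivity
  filter_upwards [h0 (ε * h / 4) (by positivity)] with i hi x
  refine (abs_deriv_le_of_abs_le (fun x => (hf.2.1 i x).hasDerivAt) (hf.2.2.2.1 i) hi (hB i)
    hpos x).trans ?_
  have h1 : 2 * (ε * h / 4) / h = ε / 2 := by field_simp; norm_num
  have h2 : B * h ≤ ε / 2 := by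
    calc B * h ≤ (|B| + 1) * h := by gcongr; linarith [le_abs_self B]
      _ = ε / 2 := by rw [hh]; field_simp
  linarith

/-- If a family with uniformly bounded derivatives tends to zero uniformly, so do the
derivatives. -/
theorem UniformlyBddDeriv.eventually_iteratedDeriv {ι : Type*} {l : Filter ι} {f : ι → ℝ → ℝ}
    (j : ℕ) (hf : UniformlyBddDeriv (j + 1) f) (h0 : ∀ ε > 0, ∀ᶠ i in l, ∀ x, |f i x| ≤ ε) :
    ∀ ε > 0, ∀ᶠ i in l, ∀ x, |iteratedDeriv j (f i) x| ≤ ε := by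
  induction j generalizing f with
  | zero => simpa using h0
  | succ j ih =>
    simp only [iteratedDeriv_succ']
    refine ih hf.2.2 (UniformlyBddDeriv.eventually_deriv (f := f) ?_ h0)
    -- Only second order control is required here; it follows from control of order j + 2 by
    -- discarding orders.
    clear ih
    induction j with
    | zero => exact hf
    | succ j ih => exact ih hf.of_succ

/-! ### The local black soliton -/

local notation "𝐰" => localBlackSoliton

theorem localBlackSoliton_neg (x : ℝ) : 𝐰 (-x) = -𝐰 x := by
  simp [localBlackSoliton, neg_div]

theorem localBlackSoliton_zero : 𝐰 0 = 0 := by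
  simp [localBlackSoliton]

theorem deficit_localBlackSoliton (x : ℝ) :
    deficit 𝐰 x = 1 / Real.cosh (x / √2) ^ 2 := by
  have h := Real.cosh_sq (x / √2)
  have h0 := Real.cosh_pos (x / √2)
  rw [deficit, localBlackSoliton, Real.tanh_eq_sinh_div_cosh, div_pow, eq_div_iff (by positivity),
    sub_mul, div_mul_cancel₀ _ (by positivity)]
  linarith

theorem deficit_localBlackSoliton_pos (x : ℝ) : 0 < deficit 𝐰 x := by
  rw [deficit_localBlackSoliton]
  have h0 := Real.cosh_pos (x / √2)
  positivity

theorem deficit_localBlackSoliton_le_one (x : ℝ) : deficit 𝐰 x ≤ 1 := by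
  rw [deficit]; nlinarith [sq_nonneg (𝐰 x)]

theorem hasDerivAt_localBlackSoliton (x : ℝ) : HasDerivAt 𝐰 (deficit 𝐰 x / √2) x := by
  have h0 := Real.cosh_pos (x / √2)
  have h1 : HasDerivAt (fun y : ℝ => y / √2) (1 / √2) x := (hasDerivAt_id x).div_const _
  have h2 := (h1.sinh).div (h1.cosh) h0.ne'
  have h3 : 𝐰 = fun y => Real.sinh (y / √2) / Real.cosh (y / √2) :=
    funext fun y => Real.tanh_eq_sinh_div_cosh _
  rw [deficit_localBlackSoliton, h3]
  refine h2.congr_deriv ?_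
  have h4 := Real.cosh_sq (x / √2)
  have h5 : Real.cosh (x / √2) * (1 / √2) * Real.cosh (x / √2) -
      Real.sinh (x / √2) * (Real.sinh (x / √2) * (1 / √2)) = 1 / √2 := by
    linear_combination (1 / √2) * h4
  rw [h5]
  ring

theorem continuous_localBlackSoliton : Continuous 𝐰 :=
  continuous_iff_continuousAt.2 fun x => (hasDerivAt_localBlackSoliton x).continuousAt

theorem continuous_deficit {u : ℝ → ℝ} (hu : Continuous u) : Continuous (deficit u) := by
  unfold deficit; fun_prop

theorem abs_localBlackSoliton_lt_one (x : ℝ) : |𝐰 x| < 1 := by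
  have := deficit_localBlackSoliton_pos x
  rw [deficit] at this
  rw [← sq_lt_one_iff_abs_lt_one]
  linarith

theorem strictMono_localBlackSoliton : StrictMono 𝐰 :=
  strictMono_of_hasDerivAt_pos hasDerivAt_localBlackSoliton fun x =>
    div_pos (deficit_localBlackSoliton_pos x) (by positivity)

theorem localBlackSoliton_pos {x : ℝ} (hx : 0 < x) : 0 < 𝐰 x := by
  simpa [localBlackSoliton_zero] using strictMono_localBlackSoliton hx

theorem tendsto_deficit_localBlackSoliton_atTop : Tendsto (deficit 𝐰) atTop (𝓝 0) := by
  have h1 : Tendsto (fun x : ℝ => Real.cosh (x / √2)) atTop atTop := by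
    refine tendsto_atTop_mono (f := fun x => Real.exp (x / √2) / 2) (fun x => ?_) ?_
    · rw [Real.cosh_eq]; have := Real.exp_pos (-(x / √2)); linarith
    · exact (Real.tendsto_exp_atTop.comp (tendsto_id.atTop_div_const (by positivity))).atTop_div_const
        two_pos
  have h2 := (tendsto_pow_atTop (α := ℝ) two_ne_zero).comp h1
  refine (tendsto_inv_atTop_zero.comp h2).congr fun x => ?_
  rw [deficit_localBlackSoliton]; simp

theorem deficit_localBlackSoliton_neg (x : ℝ) : deficit 𝐰 (-x) = deficit 𝐰 x := by
  simp [deficit, localBlackSoliton_neg]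

theorem tendsto_deficit_localBlackSoliton_atBot : Tendsto (deficit 𝐰) atBot (𝓝 0) := by
  refine (tendsto_deficit_localBlackSoliton_atTop.comp tendsto_neg_atBot_atTop).congr fun x => ?_
  exact deficit_localBlackSoliton_neg x

theorem integrable_even_of_integrableOn_Ioi {f : ℝ → ℝ} (he : ∀ x, f (-x) = f x)
    (h : IntegrableOn f (Ioi 0)) : Integrable f := by
  rw [← integrableOn_univ, ← Iic_union_Ioi (a := (0 : ℝ)), integrableOn_union]
  refine ⟨?_, h⟩
  rw [integrableOn_Iic_iff_integrableOn_Iio]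
  have := h.comp_neg
  simpa [he] using this

theorem integral_even {f : ℝ → ℝ} (he : ∀ x, f (-x) = f x) : ∫ x, f x = 2 * ∫ x in Ioi 0, f x := by
  rw [← integral_comp_abs]
  congr 1; ext x
  rcases abs_choice x with h | h <;> rw [h]
  exact (he x).symm

/-- The deficit is √2 times the derivative of a bounded increasing function. -/
theorem integrable_deficit_localBlackSoliton : Integrable (deficit 𝐰) := by
  refine integrable_even_of_integrableOn_Ioi deficit_localBlackSoliton_neg ?_
  have hlim : ∃ c, Tendsto 𝐰 atTop (𝓝 c) := by
    refine ⟨_, tendsto_atTop_ciSup strictMono_localBlackSoliton.monotone ⟨1, ?_⟩⟩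
    rintro _ ⟨x, rfl⟩
    exact (le_abs_self _).trans (abs_localBlackSoliton_lt_one x).le
  obtain ⟨c, hc⟩ := hlim
  have h := integrableOn_Ioi_deriv_of_nonneg' (a := 0) (fun x _ => hasDerivAt_localBlackSoliton x)
    (fun x _ => div_nonneg (deficit_localBlackSoliton_pos x).le (Real.sqrt_nonneg 2)) hc
  have h2 := h.const_mul (√2)
  refine h2.congr (Eventually.of_forall fun x => ?_)
  exact mul_div_cancel₀ _ (by positivity)

theorem isBCL2_deficit_localBlackSoliton : IsBCL2 (deficit 𝐰) := by
  have hc := continuous_deficit continuous_localBlackSoliton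
  have hb : ∀ x, |deficit 𝐰 x| ≤ 1 := fun x => by
    rw [abs_of_pos (deficit_localBlackSoliton_pos x)]; exact deficit_localBlackSoliton_le_one x
  refine ⟨hc, ?_, 1, hb⟩
  rw [memLp_two_iff_integrable_sq hc.aestronglyMeasurable]
  simp only [sq]
  exact integrable_deficit_localBlackSoliton.bdd_mul hc.aestronglyMeasurable (Eventually.of_forall hb)

theorem weakDeriv_localBlackSoliton_ae : weakDeriv 𝐰 =ᵐ[volume] fun x => deficit 𝐰 x / √2 :=
  weakDeriv_ae_eq hasDerivAt_localBlackSoliton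
    ((continuous_deficit continuous_localBlackSoliton).div_const _)

theorem memLp_deriv_localBlackSoliton : MemLp (fun x => deficit 𝐰 x / √2) 2 volume := by
  simpa only [div_eq_mul_inv, mul_comm] using
    (isBCL2_deficit_localBlackSoliton.const_mul (√2)⁻¹).memLp

theorem memEnergyOdd_localBlackSoliton : MemEnergyOdd 𝐰 where
  continuous := continuous_localBlackSoliton
  hasWeakDeriv := (hasWeakDeriv_of_hasDerivAt hasDerivAt_localBlackSoliton
    ((continuous_deficit continuous_localBlackSoliton).div_const _)).weakDeriv
  weakDeriv_memLp := memLp_deriv_localBlackSoliton.ae_eq weakDeriv_localBlackSoliton_ae.symm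
  deficit_memLp := isBCL2_deficit_localBlackSoliton.memLp
  odd := localBlackSoliton_neg

theorem deriv_localBlackSoliton : deriv 𝐰 = fun x => (√2)⁻¹ - (√2)⁻¹ * (𝐰 x * 𝐰 x) :=
  funext fun x => by rw [(hasDerivAt_localBlackSoliton x).deriv, deficit]; ring

/-- The derivative is a polynomial in the function itself, so bounds propagate from one order to the
next. -/
theorem uniformlyBddDeriv_localBlackSoliton (ι : Type*) (n : ℕ) :
    UniformlyBddDeriv n fun _ : ι => 𝐰 := by
  have hb : ∃ C, ∀ (_ : ι) x, |𝐰 x| ≤ C := ⟨1, fun _ x => (abs_localBlackSoliton_lt_one x).le⟩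
  induction n with
  | zero => exact ⟨hb, fun _ => continuous_localBlackSoliton⟩
  | succ n ih =>
    refine ⟨hb, fun _ x => (hasDerivAt_localBlackSoliton x).differentiableAt, ?_⟩
    simp only [deriv_localBlackSoliton]
    exact (ih.mul ih).const_sub_mul _ _

theorem exists_min_le_localBlackSoliton : ∃ K > 0, ∀ x > 0, min x 1 ≤ K * 𝐰 x := by
  have hg1 := deficit_localBlackSoliton_pos 1
  have hs : 0 < √2 := by positivity
  refine ⟨√2 / deficit 𝐰 1, by positivity, ?_⟩
  -- By the mean value theorem 𝐰 x = x 𝐰'(c) with 0 < c < x ≤ 1, and 𝐰' decreases on the positive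
  -- axis, so 𝐰'(c) ≥ 𝐰'(1).
  have key : ∀ x, 0 < x → x ≤ 1 → x ≤ √2 / deficit 𝐰 1 * 𝐰 x := fun x hx hx1 => by
    obtain ⟨c, hc, hc'⟩ := exists_hasDerivAt_eq_slope 𝐰 (fun x => deficit 𝐰 x / √2) hx
      continuous_localBlackSoliton.continuousOn (fun y _ => hasDerivAt_localBlackSoliton y)
    rw [localBlackSoliton_zero, sub_zero, sub_zero, eq_div_iff hx.ne'] at hc'
    have h1 : deficit 𝐰 1 ≤ deficit 𝐰 c := by
      have h2 : 𝐰 c ≤ 𝐰 1 := strictMono_localBlackSoliton.monotone (hc.2.le.trans hx1)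
      have h3 := localBlackSoliton_pos hc.1
      simp only [deficit]; nlinarith
    have h2 : √2 / deficit 𝐰 1 * (deficit 𝐰 c / √2 * x) = deficit 𝐰 c / deficit 𝐰 1 * x := by
      rw [div_mul_eq_mul_div, div_mul_eq_mul_div, mul_div_cancel₀ _ hs.ne', mul_div_right_comm]
    rw [← hc', h2]
    exact le_mul_of_one_le_left hx.le ((one_le_div hg1).2 h1)
  intro x hx
  rcases le_total x 1 with h | h
  · rw [min_eq_left h]; exact key x hx h
  · rw [min_eq_right h]
    refine (key 1 one_pos le_rfl).trans ?_
    gcongr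
    exact strictMono_localBlackSoliton.monotone h

/-! ### Regularity of solitons -/

theorem bounded_of_tendsto {u : ℝ → ℝ} (hu : Continuous u) {a b : ℝ} (ha : Tendsto u atTop (𝓝 a))
    (hb : Tendsto u atBot (𝓝 b)) : ∃ C, ∀ x, |u x| ≤ C := by
  have h : u =O[cocompact ℝ] (fun _ => (1 : ℝ)) := by
    rw [cocompact_eq_atBot_atTop]
    exact (hb.isBigO_one ℝ).sup (ha.isBigO_one ℝ)
  obtain ⟨C, hC⟩ := (hu.isBounded_range_iff_isBigO.2 h).exists_norm_le
  exact ⟨C, fun x => hC _ (mem_range_self x)⟩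

variable {W : SignedMeasure ℝ} {u : ℝ → ℝ}

theorem bounded_deficit (h : ∃ C, ∀ x, |u x| ≤ C) : ∃ C, ∀ x, |deficit u x| ≤ C := by
  obtain ⟨C, hC⟩ := h
  refine ⟨1 + C ^ 2, fun x => ?_⟩
  rw [deficit]
  refine (abs_sub _ _).trans ?_
  rw [abs_one, abs_pow]
  gcongr
  exact hC x

namespace IsOddMinimizerSoliton

theorem bounded (h : IsOddMinimizerSoliton W u) : ∃ C, ∀ x, |u x| ≤ C :=
  bounded_of_tendsto h.mem.continuous h.tendsto_atTop h.tendsto_atBot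

theorem isBCL2_deficit (h : IsOddMinimizerSoliton W u) : IsBCL2 (deficit u) :=
  ⟨continuous_deficit h.mem.continuous, h.mem.deficit_memLp, bounded_deficit h.bounded⟩

theorem continuous_conv_deficit (h : IsOddMinimizerSoliton W u) : Continuous (conv W (deficit u)) :=
  continuous_conv W h.isBCL2_deficit.continuous h.isBCL2_deficit.bounded

/-- The right-hand side of the equation is continuous, so the weak derivative agrees a.e. with a C¹
function `p`, and `u` agrees a.e. with a primitive of `p`. Continuity of `u` makes the last equality
hold everywhere. -/
theorem exists_classical (h : IsOddMinimizerSoliton W u) : ∃ p : ℝ → ℝ,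
    (∀ x, HasDerivAt u (p x) x) ∧ (∀ x, HasDerivAt p (-(u x * conv W (deficit u) x)) x) ∧
      weakDeriv u =ᵐ[volume] p := by
  have hc : Continuous fun x => -(u x * conv W (deficit u) x) :=
    (h.mem.continuous.mul h.continuous_conv_deficit).neg
  have hw : HasWeakDeriv (weakDeriv u) fun x => -(u x * conv W (deficit u) x) := by
    refine ⟨h.mem.hasWeakDeriv.2.1, hc.locallyIntegrable, fun φ hφ => ?_⟩
    rw [h.solution φ hφ, ← integral_neg]
    simp
  obtain ⟨p, hp, hp'⟩ := hw.exists_hasDerivAt hc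
  have hpc : Continuous p := continuous_iff_continuousAt.2 fun x => (hp x).continuousAt
  obtain ⟨q, hq, hq'⟩ := (h.mem.hasWeakDeriv.congr EventuallyEq.rfl hp').exists_hasDerivAt hpc
  have hqc : Continuous q := continuous_iff_continuousAt.2 fun x => (hq x).continuousAt
  have := (Continuous.ae_eq_iff_eq volume h.mem.continuous hqc).1 hq'
  exact ⟨p, this ▸ hq, hp, hp'⟩

theorem hasDerivAt (h : IsOddMinimizerSoliton W u) (x : ℝ) : HasDerivAt u (deriv u x) x := by
  obtain ⟨p, hp, -, -⟩ := h.exists_classical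
  exact (hp x).differentiableAt.hasDerivAt

theorem hasDerivAt_deriv (h : IsOddMinimizerSoliton W u) (x : ℝ) :
    HasDerivAt (deriv u) (-(u x * conv W (deficit u) x)) x := by
  obtain ⟨p, hp, hp', -⟩ := h.exists_classical
  have : deriv u = p := funext fun x => (hp x).deriv
  exact this ▸ hp' x

theorem weakDeriv_ae (h : IsOddMinimizerSoliton W u) : weakDeriv u =ᵐ[volume] deriv u := by
  obtain ⟨p, hp, -, hp'⟩ := h.exists_classical
  have : deriv u = p := funext fun x => (hp x).deriv
  exact this ▸ hp'

theorem continuous_deriv (h : IsOddMinimizerSoliton W u) : Continuous (deriv u) :=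
  continuous_iff_continuousAt.2 fun x => (h.hasDerivAt_deriv x).continuousAt

theorem memLp_deriv (h : IsOddMinimizerSoliton W u) : MemLp (deriv u) 2 volume :=
  h.mem.weakDeriv_memLp.ae_eq h.weakDeriv_ae

theorem map_zero (h : IsOddMinimizerSoliton W u) : u 0 = 0 := by
  have := h.mem.odd 0
  rw [neg_zero] at this
  linarith

theorem deriv_neg (h : IsOddMinimizerSoliton W u) (x : ℝ) : deriv u (-x) = deriv u x := by
  have h1 : HasDerivAt (fun x => u (-x)) (-deriv u (-x)) x := by
    have := (h.hasDerivAt (-x)).comp x (hasDerivAt_neg x)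
    rwa [mul_neg_one] at this
  have h2 : HasDerivAt (fun x => u (-x)) (-deriv u x) x := by
    simpa only [h.mem.odd] using (h.hasDerivAt x).fun_neg
  linarith [h1.unique h2]

theorem energy_eq (h : IsOddMinimizerSoliton W u) : energy W u =
    (1 / 2) * (∫ x, deriv u x ^ 2) + (1 / 4) * nonlocalForm W (deficit u) (deficit u) := by
  rw [energy, nonlocalForm]
  congr 2
  refine integral_congr_ae ?_
  filter_upwards [h.weakDeriv_ae] with x hx
  rw [hx]

theorem hasDerivAt_deficit (h : IsOddMinimizerSoliton W u) (x : ℝ) :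
    HasDerivAt (deficit u) (-(2 * u x * deriv u x)) x := by
  have := ((h.hasDerivAt x).pow 2).const_sub 1
  refine this.congr_deriv ?_
  simp

/-- The local black soliton is an admissible competitor; minimality enters the argument only through
this comparison. -/
theorem energy_le (h : IsOddMinimizerSoliton W u) :
    (1 / 2) * (∫ x, deriv u x ^ 2) + (1 / 4) * nonlocalForm W (deficit u) (deficit u) ≤
      (1 / 2) * (∫ x, (deficit 𝐰 x / √2) ^ 2) +
        (1 / 4) * nonlocalForm W (deficit 𝐰) (deficit 𝐰) := by
  rw [← h.energy_eq]
  refine (h.minimal _ memEnergyOdd_localBlackSoliton).trans_eq ?_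
  rw [energy, nonlocalForm]
  congr 2
  refine integral_congr_ae ?_
  filter_upwards [weakDeriv_localBlackSoliton_ae] with x hx
  rw [hx]

end IsOddMinimizerSoliton

/-! ### Uniform bounds -/

/-- Agmon's inequality. -/
theorem sq_le_two_mul_sqrt_mul_sqrt {f f' : ℝ → ℝ} (hd : ∀ x, HasDerivAt f (f' x) x)
    (hf : MemLp f 2 volume) (hf' : MemLp f' 2 volume) (hlim : Tendsto f atBot (𝓝 0)) (x : ℝ) :
    f x ^ 2 ≤ 2 * (√(∫ x, f x ^ 2) * √(∫ x, f' x ^ 2)) := by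
  have hd2 : ∀ x, HasDerivAt (fun x => f x ^ 2) (2 * (f x * f' x)) x := fun x => by
    refine ((hd x).pow 2).congr_deriv ?_
    simp; ring
  have hI : Integrable (fun x => 2 * (f x * f' x)) := (MemLp.integrable_mul_two hf hf').const_mul 2
  have h1 := integral_Iic_of_hasDerivAt_of_tendsto' (a := x) (fun y _ => hd2 y) hI.integrableOn
    (by simpa using hlim.pow 2)
  rw [sub_zero] at h1
  rw [← h1]
  calc ∫ y in Iic x, 2 * (f y * f' y) ≤ ∫ y in Iic x, 2 * (|f y| * |f' y|) := by
        refine integral_mono hI.integrableOn ?_ fun y => ?_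
        · exact ((MemLp.integrable_mul_two hf.norm hf'.norm).const_mul 2).integrableOn
        · show 2 * (f y * f' y) ≤ 2 * (|f y| * |f' y|)
          rw [← abs_mul]; linarith [le_abs_self (f y * f' y)]
    _ ≤ ∫ y, 2 * (|f y| * |f' y|) :=
        setIntegral_le_integral ((MemLp.integrable_mul_two hf.norm hf'.norm).const_mul 2)
          (Eventually.of_forall fun y => by positivity)
    _ ≤ _ := by
      rw [integral_const_mul]
      gcongr
      have := abs_integral_mul_le hf.norm hf'.norm
      simp only [Real.norm_eq_abs, sq_abs] at this
      exact (le_abs_self _).trans this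

theorem IsOddMinimizerSoliton.tendsto_deficit_atBot (h : IsOddMinimizerSoliton W u) :
    Tendsto (deficit u) atBot (𝓝 0) := by
  have := (h.tendsto_atBot.pow 2).const_sub 1
  rwa [neg_one_sq, sub_self] at this

theorem memLp_mul_of_bounded {f g : ℝ → ℝ} (hf : Continuous f) (hb : ∃ C, ∀ x, |f x| ≤ C)
    (hg : MemLp g 2 volume) : MemLp (fun x => f x * g x) 2 volume := by
  obtain ⟨C, hC⟩ := hb
  refine MemLp.of_le_mul (c := C) hg (hf.aestronglyMeasurable.mul hg.1)
    (Eventually.of_forall fun x => ?_)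
  rw [norm_mul]
  gcongr
  exact hC x

/-- The bound for the sup norm of the deficit in terms of the two parts of the energy. -/
theorem IsOddMinimizerSoliton.abs_deficit_le (h : IsOddMinimizerSoliton W u) {κ K : ℝ}
    (hκ : 0 ≤ κ) (hW : FourierLowerBound W κ) (hK : ∫ x, deriv u x ^ 2 ≤ K)
    (hK' : nonlocalForm W (deficit u) (deficit u) ≤ K) :
    (∀ x, |deficit u x| ≤ 4 * K * (1 + 4 * κ) + 1) ∧
      ∫ x, deficit u x ^ 2 ≤ K + κ * (4 * (4 * K * (1 + 4 * κ) + 2) * K) := by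
  have hK0 : 0 ≤ K := (integral_nonneg fun x => sq_nonneg _).trans hK
  have hc' : Continuous fun x => -(2 * u x * deriv u x) :=
    ((continuous_const.mul h.mem.continuous).mul h.continuous_deriv).neg
  have hL' : MemLp (fun x => -(2 * u x * deriv u x)) 2 volume := by
    have := (memLp_mul_of_bounded h.mem.continuous h.bounded h.memLp_deriv).const_mul (-2)
    refine this.ae_eq (Eventually.of_forall fun x => ?_)
    ring
  -- The deficit has derivative -2 u u', and a bound m on its modulus gives u² ≤ 1 + m.
  have hderiv : ∀ m, (∀ x, |deficit u x| ≤ m) →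
      ∫ x, (-(2 * u x * deriv u x)) ^ 2 ≤ 4 * (1 + m) * K := fun m hm => by
    have hm0 : 0 ≤ m := (abs_nonneg _).trans (hm 0)
    calc _ ≤ ∫ x, 4 * (1 + m) * deriv u x ^ 2 := by
          refine integral_mono hL'.integrable_sq (h.memLp_deriv.integrable_sq.const_mul _)
            fun x => ?_
          have h1 := (abs_le.1 (hm x)).1
          rw [deficit] at h1
          have h2 : u x ^ 2 ≤ 1 + m := by linarith
          have : (-(2 * u x * deriv u x)) ^ 2 = 4 * u x ^ 2 * deriv u x ^ 2 := by ring
          show (-(2 * u x * deriv u x)) ^ 2 ≤ 4 * (1 + m) * deriv u x ^ 2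
          rw [this]
          gcongr
      _ ≤ _ := by rw [integral_const_mul]; gcongr
  have hdef : ∀ m, (∀ x, |deficit u x| ≤ m) →
      ∫ x, deficit u x ^ 2 ≤ K + κ * (4 * (1 + m) * K) := fun m hm => by
    refine (integral_sq_le_nonlocalForm_add hκ hW h.isBCL2_deficit h.hasDerivAt_deficit hc'
      hL').trans ?_
    gcongr
    exact hderiv m hm
  have hbdd : BddAbove (range fun x => |deficit u x|) := by
    obtain ⟨C, hC⟩ := h.isBCL2_deficit.bounded
    exact ⟨C, by rintro _ ⟨x, rfl⟩; exact hC x⟩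
  set m : ℝ := ⨆ x, |deficit u x| with hm
  have hmle : ∀ x, |deficit u x| ≤ m := fun x => le_ciSup hbdd x
  have hm0 : 0 ≤ m := (abs_nonneg _).trans (hmle 0)
  -- Agmon's inequality bounds the square of the supremum m by an expression that grows only
  -- linearly in m, so m can be absorbed. The bound inside the square root is rounded up to a
  -- perfect square.
  have hsq : ∀ x, deficit u x ^ 2 ≤ 4 * K * (1 + 4 * κ) * (1 + m) := fun x => by
    refine (sq_le_two_mul_sqrt_mul_sqrt h.hasDerivAt_deficit h.isBCL2_deficit.memLp hL'
      h.tendsto_deficit_atBot x).trans ?_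
    rw [← Real.sqrt_mul (integral_nonneg fun x => sq_nonneg _)]
    have h1 : (∫ x, deficit u x ^ 2) * ∫ x, (-(2 * u x * deriv u x)) ^ 2 ≤
        (2 * K * (1 + 4 * κ) * (1 + m)) ^ 2 := by
      calc _ ≤ (K + κ * (4 * (1 + m) * K)) * (4 * (1 + m) * K) :=
            mul_le_mul (hdef m hmle) (hderiv m hmle) (integral_nonneg fun x => sq_nonneg _)
              (by positivity)
        _ = (4 * K ^ 2 * (1 + m)) * (1 + 4 * κ * (1 + m)) := by ring
        _ ≤ (4 * K ^ 2 * (1 + m)) * ((1 + 4 * κ) ^ 2 * (1 + m)) := by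
            gcongr
            nlinarith [mul_nonneg hκ hm0, mul_nonneg (mul_nonneg hκ hκ) hm0]
        _ = _ := by ring
    have h2 := Real.sqrt_le_sqrt h1
    rw [Real.sqrt_sq (by positivity)] at h2
    linarith
  -- From m² ≤ L(1 + m): if m > L + 1 then m² > (L + 1) m = L m + m > L m + L.
  have hm2 : m ≤ 4 * K * (1 + 4 * κ) + 1 := by
    have hL0 : 0 ≤ 4 * K * (1 + 4 * κ) := by positivity
    generalize 4 * K * (1 + 4 * κ) = L at hsq hL0 ⊢
    have h1 : m ≤ √(L * (1 + m)) :=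
      ciSup_le fun x => Real.abs_le_sqrt (hsq x)
    have h2 : m ^ 2 ≤ L * (1 + m) := by
      calc m ^ 2 ≤ √(L * (1 + m)) ^ 2 := by gcongr
        _ = _ := Real.sq_sqrt (by positivity)
    nlinarith
  refine ⟨fun x => (hmle x).trans hm2, (hdef _ fun x => (hmle x).trans hm2).trans (le_of_eq ?_)⟩
  ring

/-! ### Uniform bounds for a family of solitons -/

section Family

variable {ι : Type*} {W : ι → SignedMeasure ℝ} {u : ι → ℝ → ℝ} {κ : ℝ} {M : NNReal}

theorem exists_uniform_bound (hκ : 0 ≤ κ) (hW : ∀ i, FourierLowerBound (W i) κ)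
    (hM : ∀ i, tvNorm (W i) ≤ M) (hu : ∀ i, IsOddMinimizerSoliton (W i) (u i)) :
    ∃ C, ∀ i, (∀ x, |u i x| ≤ C) ∧ ∫ x, deficit (u i) x ^ 2 ≤ C := by
  -- Four times a bound for the energy of the local black soliton. Both parts of the energy of `u`
  -- are nonnegative, with weights 1/2 and 1/4, so the factor 4 covers each of them.
  set K : ℝ := 4 * ((1 / 2) * (∫ x, (deficit 𝐰 x / √2) ^ 2) + (1 / 4) * (M * ∫ x, deficit 𝐰 x ^ 2))
    with hK
  set L : ℝ := 4 * K * (1 + 4 * κ) + 1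
  refine ⟨max (1 + L) (K + κ * (4 * (L + 1) * K)), fun i => ?_⟩
  have h1 := (hu i).energy_le
  have h2 : nonlocalForm (W i) (deficit 𝐰) (deficit 𝐰) ≤ M * ∫ x, deficit 𝐰 x ^ 2 := by
    refine (nonlocalForm_self_le (W i) isBCL2_deficit_localBlackSoliton).trans ?_
    refine mul_le_mul_of_nonneg_right (real_univ_add_le (hM i)) (integral_nonneg fun x => sq_nonneg _)
  have h3 := nonlocalForm_self_nonneg (hW i) (hu i).isBCL2_deficit
  have h4 : 0 ≤ ∫ x, deriv (u i) x ^ 2 := integral_nonneg fun x => sq_nonneg _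
  obtain ⟨h5, h6⟩ := (hu i).abs_deficit_le (K := K) hκ (hW i) (by linarith) (by linarith)
  refine ⟨fun x => le_trans ?_ (le_max_left _ _), h6.trans (le_trans (le_of_eq ?_) (le_max_right _ _))⟩
  · have h7 := (abs_le.1 (h5 x)).1
    rw [deficit] at h7
    have h8 : 0 ≤ L := (abs_nonneg _).trans (h5 x)
    refine abs_le_of_sq_le_sq ?_ (by positivity)
    nlinarith
  · ring

/-- Bootstrap on u'' = -u (W * (1 - u²)): the right-hand side has as many bounded derivatives as
`u`, so each pass gains two orders. The first derivative is recovered by interpolation with step 1.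
-/
theorem uniformlyBddDeriv_of_bounded (hM : ∀ i, tvNorm (W i) ≤ M)
    (hu : ∀ i, IsOddMinimizerSoliton (W i) (u i)) (hb : ∃ C, ∀ i x, |u i x| ≤ C) (n : ℕ) :
    UniformlyBddDeriv n u := by
  have h0 : UniformlyBddDeriv 0 u := ⟨hb, fun i => (hu i).mem.continuous⟩
  have step : ∀ n, UniformlyBddDeriv n u → UniformlyBddDeriv (n + 2) u := fun n hn => by
    have hd : UniformlyBddDeriv n fun i => deficit (u i) := by
      have := (hn.mul hn).const_sub_mul 1 1
      have e : (fun i => deficit (u i)) = fun i x => 1 - 1 * (u i x * u i x) :=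
        funext fun i => funext fun x => by rw [deficit]; ring
      rwa [e]
    have h2 : UniformlyBddDeriv n fun i => deriv (deriv (u i)) := by
      have := (hn.mul (hd.conv hM)).const_sub_mul 0 1
      have e : (fun i => deriv (deriv (u i))) =
          fun i x => 0 - 1 * (u i x * conv (W i) (deficit (u i)) x) :=
        funext fun i => funext fun x => by rw [((hu i).hasDerivAt_deriv x).deriv]; ring
      rwa [e]
    have hdd : ∀ i, Differentiable ℝ (deriv (u i)) := fun i x =>
      ((hu i).hasDerivAt_deriv x).differentiableAt
    refine ⟨hb, fun i x => ((hu i).hasDerivAt x).differentiableAt, ?_, hdd, h2⟩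
    obtain ⟨A, hA⟩ := hb
    obtain ⟨B, hB⟩ := h2.bdd
    exact ⟨_, fun i x => abs_deriv_le_of_abs_le (hu i).hasDerivAt (hdd i) (hA i) (hB i) one_pos x⟩
  induction n using Nat.strong_induction_on with
  | _ n ih =>
    match n, ih with
    | 0, _ => exact h0
    | 1, _ => exact (step 0 h0).of_succ
    | n + 2, ih => exact step n (ih n (by omega))

theorem exists_abs_le_mul_abs (h : UniformlyBddDeriv 1 u) (h0 : ∀ i, u i 0 = 0) :
    ∃ L, ∀ i x, |u i x| ≤ L * |x| := by
  obtain ⟨L, hL⟩ := h.2.2.bdd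
  refine ⟨L, fun i x => ?_⟩
  have := Convex.norm_image_sub_le_of_norm_deriv_le (fun y _ => h.2.1 i y) (fun y _ => hL i y)
    convex_univ (mem_univ 0) (mem_univ x)
  simpa [h0] using this

/-- Near 0 a common Lipschitz constant is compared with the linear vanishing of 𝐰, and away from 0
the sup bound suffices. The resulting uniform bound on u/𝐰 tames the pole of 𝐰'/𝐰 in every later
estimate. -/
theorem exists_abs_le_mul_localBlackSoliton (h : UniformlyBddDeriv 1 u) (h0 : ∀ i, u i 0 = 0) :
    ∃ Q, ∀ i, ∀ x > 0, |u i x| ≤ Q * 𝐰 x := by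
  obtain ⟨C, hC⟩ := h.bdd
  obtain ⟨L, hL⟩ := exists_abs_le_mul_abs h h0
  obtain ⟨K, hK, hK'⟩ := exists_min_le_localBlackSoliton
  refine ⟨max |C| |L| * K, fun i x hx => ?_⟩
  rw [mul_assoc]
  have h1 : |u i x| ≤ max |C| |L| * min x 1 := by
    rcases le_total x 1 with hx1 | hx1
    · rw [min_eq_left hx1]
      refine (hL i x).trans ?_
      rw [abs_of_pos hx]
      gcongr
      exact (le_abs_self L).trans (le_max_right _ _)
    · rw [min_eq_right hx1, mul_one]
      exact (hC i x).trans ((le_abs_self C).trans (le_max_left _ _))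
  exact h1.trans (mul_le_mul_of_nonneg_left (hK' x hx) (by positivity))

end Family

/-! ### The factorization of the linearized energy -/

/-- The logarithmic derivative of the local black soliton. -/
def logDerivSoliton (x : ℝ) : ℝ := deficit 𝐰 x / √2 / 𝐰 x

theorem measurable_logDerivSoliton : Measurable logDerivSoliton :=
  (((continuous_deficit continuous_localBlackSoliton).div_const _).measurable).div
    continuous_localBlackSoliton.measurable

theorem hasDerivAt_deficit_localBlackSoliton (x : ℝ) :
    HasDerivAt (deficit 𝐰) (-(2 * 𝐰 x * (deficit 𝐰 x / √2))) x := by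
  refine (((hasDerivAt_localBlackSoliton x).pow 2).const_sub 1).congr_deriv ?_
  simp

/-- The Riccati form of 𝐰'' = -(1 - 𝐰²) 𝐰; this is what completes the square in the second
variation. -/
theorem hasDerivAt_logDerivSoliton {x : ℝ} (hx : 0 < x) :
    HasDerivAt logDerivSoliton (-deficit 𝐰 x - logDerivSoliton x ^ 2) x := by
  have hw := localBlackSoliton_pos hx
  refine (((hasDerivAt_deficit_localBlackSoliton x).div_const (√2)).div
    (hasDerivAt_localBlackSoliton x) hw.ne').congr_deriv ?_
  have h2 : √2 * √2 = 2 := Real.mul_self_sqrt zero_le_two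
  have hs : √2 ≠ 0 := by positivity
  rw [logDerivSoliton]
  generalize deficit 𝐰 x = g
  field_simp
  have h3 : √2 ^ 2 = 2 := by rw [sq, h2]
  rw [h3]
  ring

/-- The remainder `f' - (𝐰'/𝐰) f`. -/
def remainder (f f' : ℝ → ℝ) (x : ℝ) : ℝ := f' x - logDerivSoliton x * f x

section Factorization

variable {f f' : ℝ → ℝ} {C Q : ℝ}

/-- The factor 𝐰 in the bound for `f` cancels the pole of 𝐰'/𝐰 at 0 and leaves Q 𝐰', which is square
integrable. -/
theorem abs_logDerivSoliton_mul_le (hQ : ∀ x > 0, |f x| ≤ Q * 𝐰 x) {x : ℝ} (hx : 0 < x) :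
    |logDerivSoliton x * f x| ≤ Q * (deficit 𝐰 x / √2) := by
  have hw := localBlackSoliton_pos hx
  have hg := deficit_localBlackSoliton_pos x
  have hs : 0 < √2 := by positivity
  rw [abs_mul, logDerivSoliton, abs_of_pos (by positivity), div_mul_eq_mul_div, div_le_iff₀ hw]
  calc _ ≤ deficit 𝐰 x / √2 * (Q * 𝐰 x) := by gcongr; exact hQ x hx
    _ = _ := by ring

theorem memLp_logDerivSoliton_mul (hf : Continuous f) (hQ : ∀ x > 0, |f x| ≤ Q * 𝐰 x) :
    MemLp (fun x => logDerivSoliton x * f x) 2 (volume.restrict (Ioi 0)) := by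
  refine MemLp.of_le_mul (c := Q) (memLp_deriv_localBlackSoliton.mono_measure Measure.restrict_le_self)
    (measurable_logDerivSoliton.mul hf.measurable).aestronglyMeasurable ?_
  refine (ae_restrict_iff' measurableSet_Ioi).2 (Eventually.of_forall fun x hx => ?_)
  have hg := deficit_localBlackSoliton_pos x
  rw [Real.norm_eq_abs, Real.norm_of_nonneg (by positivity)]
  exact abs_logDerivSoliton_mul_le hQ hx

theorem memLp_remainder (hf : Continuous f) (hf' : MemLp f' 2 volume)
    (hQ : ∀ x > 0, |f x| ≤ Q * 𝐰 x) :
    MemLp (remainder f f') 2 (volume.restrict (Ioi 0)) :=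
  (hf'.mono_measure Measure.restrict_le_self).sub (memLp_logDerivSoliton_mul hf hQ)

theorem integrable_deficit_mul_sq (hf : Continuous f) (hC : ∀ x, |f x| ≤ C) :
    Integrable fun x => deficit 𝐰 x * f x ^ 2 := by
  refine integrable_deficit_localBlackSoliton.mul_bdd (c := C ^ 2)
    (hf.pow 2).aestronglyMeasurable (Eventually.of_forall fun x => ?_)
  rw [norm_pow]
  gcongr
  exact hC x

/-- The second variation of the local energy at the black soliton is a perfect square. -/
theorem integral_sq_sub_eq_remainder (hd : ∀ x, HasDerivAt f (f' x) x) (hf' : MemLp f' 2 volume)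
    (hC : ∀ x, |f x| ≤ C) (hQ : ∀ x > 0, |f x| ≤ Q * 𝐰 x) (h0 : f 0 = 0)
    (hodd : ∀ x, f (-x) = -f x) (heven : ∀ x, f' (-x) = f' x) :
    (∫ x, f' x ^ 2) - ∫ x, deficit 𝐰 x * f x ^ 2 = 2 * ∫ x in Ioi 0, remainder f f' x ^ 2 := by
  have hf : Continuous f := continuous_iff_continuousAt.2 fun x => (hd x).continuousAt
  have hgI := integrable_deficit_mul_sq hf hC
  have hrI := (memLp_remainder hf hf' hQ).integrable_sq
  have hC0 : 0 ≤ C := (abs_nonneg _).trans (hC 0)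
  have hQ0 : 0 ≤ Q := by
    have h1 := (abs_nonneg _).trans (hQ 1 one_pos)
    exact nonneg_of_mul_nonneg_left h1 (localBlackSoliton_pos one_pos)
  -- The boundary term a f² with a = 𝐰'/𝐰. By the Riccati equation F' = f'² - g f² - (f' - a f)²,
  -- and F vanishes at 0 and at infinity, so the integral of F' over the half-line is zero.
  let F : ℝ → ℝ := fun x => logDerivSoliton x * f x * f x
  have hFb : ∀ x > 0, ‖F x‖ ≤ Q * (deficit 𝐰 x / √2) * |f x| := fun x hx => by
    rw [Real.norm_eq_abs, abs_mul]
    gcongr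
    exact abs_logDerivSoliton_mul_le hQ hx
  have hF0 : F 0 = 0 := by simp [F, h0]
  have hFd : ∀ x ∈ Ioi (0 : ℝ), HasDerivAt F
      ((f' x ^ 2 - deficit 𝐰 x * f x ^ 2) - remainder f f' x ^ 2) x := fun x hx => by
    refine (((hasDerivAt_logDerivSoliton hx).mul (hd x)).mul (hd x)).congr_deriv ?_
    simp only [remainder, Pi.mul_apply]
    ring
  have hcont : ContinuousWithinAt F (Ici 0) 0 := by
    rw [ContinuousWithinAt, hF0]
    have hlim : Tendsto (fun x => Q * (deficit 𝐰 x / √2) * |f x|) (𝓝[Ici 0] 0) (𝓝 0) := by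
      have hc : Continuous fun x => Q * (deficit 𝐰 x / √2) * |f x| :=
        (continuous_const.mul ((continuous_deficit continuous_localBlackSoliton).div_const _)).mul
          hf.abs
      have := (hc.tendsto 0).mono_left (nhdsWithin_le_nhds (s := Ici 0))
      simpa [h0] using this
    refine squeeze_zero_norm' ?_ hlim
    filter_upwards [self_mem_nhdsWithin] with x (hx : 0 ≤ x)
    rcases hx.eq_or_lt with rfl | hx
    · simp [hF0, h0]
    · exact hFb x hx
  have htop : Tendsto F atTop (𝓝 0) := by
    have hlim : Tendsto (fun x => Q * (deficit 𝐰 x / √2) * C) atTop (𝓝 0) := by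
      simpa using ((tendsto_deficit_localBlackSoliton_atTop.div_const (√2)).const_mul Q).mul_const C
    refine squeeze_zero_norm' ?_ hlim
    filter_upwards [eventually_gt_atTop 0] with x hx
    refine (hFb x hx).trans ?_
    have hg := deficit_localBlackSoliton_pos x
    gcongr
    exact hC x
  have key := integral_Ioi_of_hasDerivAt_of_tendsto hcont hFd
    ((hf'.integrable_sq.integrableOn.sub hgI.integrableOn).sub hrI) htop
  have hs : ∫ x in Ioi 0, (f' x ^ 2 - deficit 𝐰 x * f x ^ 2 - remainder f f' x ^ 2) =
      (∫ x in Ioi 0, f' x ^ 2) - (∫ x in Ioi 0, deficit 𝐰 x * f x ^ 2) -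
        ∫ x in Ioi 0, remainder f f' x ^ 2 := by
    rw [← integral_sub hf'.integrable_sq.integrableOn hgI.integrableOn]
    exact integral_sub (hf'.integrable_sq.integrableOn.sub hgI.integrableOn) hrI
  rw [hF0, sub_zero, hs] at key
  rw [integral_even (f := fun x => f' x ^ 2) (fun x => by rw [heven]),
    integral_even (f := fun x => deficit 𝐰 x * f x ^ 2)
      (fun x => by rw [hodd, deficit_localBlackSoliton_neg, neg_sq])]
  linarith

end Factorization

/-- For f = 𝐰 the remainder 𝐰' - (𝐰'/𝐰) 𝐰 vanishes identically on the half-line. -/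
theorem integral_deriv_localBlackSoliton_sq :
    (∫ x, (deficit 𝐰 x / √2) ^ 2) - ∫ x, deficit 𝐰 x * 𝐰 x ^ 2 = 0 := by
  rw [integral_sq_sub_eq_remainder hasDerivAt_localBlackSoliton memLp_deriv_localBlackSoliton
    (fun x => (abs_localBlackSoliton_lt_one x).le) (Q := 1)
    (fun x hx => by rw [abs_of_pos (localBlackSoliton_pos hx), one_mul]) localBlackSoliton_zero
    localBlackSoliton_neg (fun x => by rw [deficit_localBlackSoliton_neg])]
  rw [setIntegral_eq_zero_of_forall_eq_zero, mul_zero]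
  intro x hx
  have hw := localBlackSoliton_pos hx
  rw [remainder, logDerivSoliton, div_mul_cancel₀ _ hw.ne', sub_self]
  simp

/-- The difference of the deficits of `u` and of the local black soliton. -/
def deficitGap (u : ℝ → ℝ) (x : ℝ) : ℝ := deficit u x + -1 * deficit 𝐰 x

theorem deficitGap_eq (u : ℝ → ℝ) (x : ℝ) : deficitGap u x = 𝐰 x ^ 2 - u x ^ 2 := by
  simp only [deficitGap, deficit]; ring

/-! ### Minimality compared with the local black soliton -/

namespace IsOddMinimizerSoliton

variable {W : SignedMeasure ℝ} {u : ℝ → ℝ} {C Q τ : ℝ}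

theorem isBCL2_deficitGap (h : IsOddMinimizerSoliton W u) : IsBCL2 (deficitGap u) :=
  h.isBCL2_deficit.add (isBCL2_deficit_localBlackSoliton.const_mul (-1))

theorem integral_deficit_mul_deficit (h : IsOddMinimizerSoliton W u) (hC : ∀ x, |u x| ≤ C) :
    ∫ x, deficit u x * deficit 𝐰 x = (∫ x, deficit 𝐰 x) - ∫ x, deficit 𝐰 x * u x ^ 2 := by
  rw [← integral_sub integrable_deficit_localBlackSoliton
    (integrable_deficit_mul_sq h.mem.continuous hC)]
  congr 1; ext x
  simp only [deficit]; ring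

theorem integral_deficit_localBlackSoliton_sq :
    ∫ x, deficit 𝐰 x * deficit 𝐰 x = (∫ x, deficit 𝐰 x) - ∫ x, deficit 𝐰 x * 𝐰 x ^ 2 := by
  rw [← integral_sub integrable_deficit_localBlackSoliton
    (integrable_deficit_mul_sq continuous_localBlackSoliton
      (fun x => (abs_localBlackSoliton_lt_one x).le))]
  congr 1; ext x
  simp only [deficit]; ring

/-- Minimality controls the remainder and the nonlocal form of the gap by the distance between
`W` and a Dirac mass at the origin, tested against the local black soliton. -/
theorem remainder_add_nonlocalForm_le (h : IsOddMinimizerSoliton W u)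
    (hC : ∀ x, |u x| ≤ C) (hQ : ∀ x > 0, |u x| ≤ Q * 𝐰 x)
    (hτ : √(∫ ξ, (‖fourierSigned W (2 * Real.pi * ξ) - 1‖ * ‖fourierL2 (deficit 𝐰) ξ‖) ^ 2) ≤ τ) :
    (∫ x in Ioi 0, remainder u (deriv u) x ^ 2) +
      (1 / 4) * nonlocalForm W (deficitGap u) (deficitGap u) ≤
        (1 / 2) * ((√(∫ x, deficit u x ^ 2) + √(∫ x, deficit 𝐰 x ^ 2)) * τ) := by
  have hg := isBCL2_deficit_localBlackSoliton
  have h1 := nonlocalForm_add_mul W h.isBCL2_deficit hg (-1)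
  have h2 := h.energy_le
  have h3 := integral_sq_sub_eq_remainder h.hasDerivAt h.memLp_deriv hC hQ h.map_zero h.mem.odd
    h.deriv_neg
  have h4 := integral_deriv_localBlackSoliton_sq
  -- The three terms containing g = `deficit 𝐰` are replaced by L² products at a cost proportional
  -- to τ. The products combine to (∫ g u² - ∫ g 𝐰²)/2, precisely the potential terms in `h3` and
  -- `h4`.
  have b1 := (abs_nonlocalForm_sub_le W h.isBCL2_deficit hg).trans
    (mul_le_mul_of_nonneg_left hτ (Real.sqrt_nonneg _))
  have b2 := (abs_nonlocalForm_sub_le' W h.isBCL2_deficit hg).trans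
    (mul_le_mul_of_nonneg_left hτ (Real.sqrt_nonneg _))
  have b3 := (abs_nonlocalForm_sub_le W hg hg).trans
    (mul_le_mul_of_nonneg_left hτ (Real.sqrt_nonneg _))
  rw [h.integral_deficit_mul_deficit hC] at b1
  rw [h.integral_deficit_mul_deficit hC] at b2
  rw [integral_deficit_localBlackSoliton_sq] at b3
  have b1' := (abs_le.1 b1).1
  have b2' := (abs_le.1 b2).1
  have b3' := (abs_le.1 b3).2
  change nonlocalForm W (deficitGap u) (deficitGap u) = _ at h1
  rw [h1]
  linarith

/-- The `L²` product of the gap with the deficit of the local black soliton is small. -/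
theorem abs_integral_deficitGap_mul_le (h : IsOddMinimizerSoliton W u) {κ : ℝ}
    (hW : FourierLowerBound W κ)
    (hτ : √(∫ ξ, (‖fourierSigned W (2 * Real.pi * ξ) - 1‖ * ‖fourierL2 (deficit 𝐰) ξ‖) ^ 2) ≤ τ) :
    |∫ x, deficitGap u x * deficit 𝐰 x| ≤
      √(nonlocalForm W (deficitGap u) (deficitGap u) * nonlocalForm W (deficit 𝐰) (deficit 𝐰)) +
        √(∫ x, deficitGap u x ^ 2) * τ := by
  have hg := isBCL2_deficit_localBlackSoliton
  have hh := h.isBCL2_deficitGap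
  have b1 := (abs_nonlocalForm_sub_le W hh hg).trans
    (mul_le_mul_of_nonneg_left hτ (Real.sqrt_nonneg _))
  have b2 := (abs_nonlocalForm_sub_le' W hh hg).trans
    (mul_le_mul_of_nonneg_left hτ (Real.sqrt_nonneg _))
  set b := nonlocalForm W (deficitGap u) (deficit 𝐰) + nonlocalForm W (deficit 𝐰) (deficitGap u)
  -- Cauchy–Schwarz for the nonnegative form: t ↦ B(h + t g, h + t g) is a nonnegative quadratic
  -- polynomial whose linear coefficient is the symmetrized mixed term `b`.
  have hdisc := discrim_le_zero (a := nonlocalForm W (deficit 𝐰) (deficit 𝐰)) (b := b)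
    (c := nonlocalForm W (deficitGap u) (deficitGap u)) fun t => by
      have h1 := nonlocalForm_self_nonneg hW (hh.add (hg.const_mul t))
      rw [nonlocalForm_add_mul W hh hg t] at h1
      linarith
  rw [discrim] at hdisc
  have h3 : |b / 2| ≤ √(nonlocalForm W (deficitGap u) (deficitGap u) *
      nonlocalForm W (deficit 𝐰) (deficit 𝐰)) := Real.abs_le_sqrt (by linarith)
  rw [abs_le] at b1 b2 h3 ⊢
  constructor <;> linarith

end IsOddMinimizerSoliton

/-! ### The local limit -/

/-- A family of odd minimizing solitons for potentials converging to a Dirac mass. -/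
structure IsLocalizingFamily {ι : Type*} (l : Filter ι) (W : ι → SignedMeasure ℝ)
    (u : ι → ℝ → ℝ) (κ : ℝ) (M : NNReal) : Prop where
  nonneg : 0 ≤ κ
  lower : ∀ i, FourierLowerBound (W i) κ
  tvNorm_le : ∀ i, tvNorm (W i) ≤ M
  soliton : ∀ i, IsOddMinimizerSoliton (W i) (u i)
  tendsto_fourier : ∃ α : ℝ, ∀ᵐ ξ : ℝ,
    Tendsto (fun i => fourierMeasure (jordanPos (W i)) ξ) l (𝓝 ((1 + α : ℝ) : ℂ)) ∧
    Tendsto (fun i => fourierMeasure (jordanNeg (W i)) ξ) l (𝓝 (α : ℂ))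

namespace IsLocalizingFamily

variable {ι : Type*} {l : Filter ι} {W : ι → SignedMeasure ℝ} {u : ι → ℝ → ℝ} {κ : ℝ} {M : NNReal}

/-- The symbol error of the potential `W`, tested against the local black soliton. -/
def symbolError (W : SignedMeasure ℝ) : ℝ :=
  √(∫ ξ, (‖fourierSigned W (2 * Real.pi * ξ) - 1‖ * ‖fourierL2 (deficit 𝐰) ξ‖) ^ 2)

theorem tendsto_symbolError [l.IsCountablyGenerated] (h : IsLocalizingFamily l W u κ M) :
    Tendsto (fun i => symbolError (W i)) l (𝓝 0) := by
  obtain ⟨α, hα⟩ := h.tendsto_fourier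
  exact tendsto_fourierSigned_sub_one hα (Eventually.of_forall h.tvNorm_le) _

theorem exists_bound (h : IsLocalizingFamily l W u κ M) :
    ∃ C, ∀ i, (∀ x, |u i x| ≤ C) ∧ ∫ x, deficit (u i) x ^ 2 ≤ C :=
  exists_uniform_bound h.nonneg h.lower h.tvNorm_le h.soliton

theorem uniformlyBddDeriv (h : IsLocalizingFamily l W u κ M) (n : ℕ) : UniformlyBddDeriv n u := by
  obtain ⟨C, hC⟩ := h.exists_bound
  exact uniformlyBddDeriv_of_bounded h.tvNorm_le h.soliton ⟨C, fun i => (hC i).1⟩ n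

theorem exists_ratio_bound (h : IsLocalizingFamily l W u κ M) :
    ∃ Q, ∀ i, ∀ x > 0, |u i x| ≤ Q * 𝐰 x :=
  exists_abs_le_mul_localBlackSoliton (h.uniformlyBddDeriv 1) fun i => (h.soliton i).map_zero

theorem nonlocalForm_nonneg (h : IsLocalizingFamily l W u κ M) (i : ι) :
    0 ≤ nonlocalForm (W i) (deficitGap (u i)) (deficitGap (u i)) :=
  nonlocalForm_self_nonneg (h.lower i) (h.soliton i).isBCL2_deficitGap

theorem tendsto_remainder_add [l.IsCountablyGenerated] (h : IsLocalizingFamily l W u κ M) :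
    Tendsto (fun i => (∫ x in Ioi 0, remainder (u i) (deriv (u i)) x ^ 2) +
      (1 / 4) * nonlocalForm (W i) (deficitGap (u i)) (deficitGap (u i))) l (𝓝 0) := by
  obtain ⟨C, hC⟩ := h.exists_bound
  obtain ⟨Q, hQ⟩ := h.exists_ratio_bound
  have hlim : Tendsto (fun i => (1 / 2) * ((√C + √(∫ x, deficit 𝐰 x ^ 2)) * symbolError (W i)))
      l (𝓝 0) := by
    have := (h.tendsto_symbolError.const_mul (√C + √(∫ x, deficit 𝐰 x ^ 2))).const_mul (1 / 2)
    rwa [mul_zero, mul_zero] at this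
  refine squeeze_zero (fun i => ?_) (fun i => ?_) hlim
  · exact add_nonneg (integral_nonneg fun x => sq_nonneg _)
      (mul_nonneg (by norm_num) (h.nonlocalForm_nonneg i))
  · refine ((h.soliton i).remainder_add_nonlocalForm_le (hC i).1 (hQ i) le_rfl).trans ?_
    have : 0 ≤ symbolError (W i) := Real.sqrt_nonneg _
    change (1 / 2) * ((√(∫ x, deficit (u i) x ^ 2) + √(∫ x, deficit 𝐰 x ^ 2)) *
      symbolError (W i)) ≤ _
    gcongr
    exact (hC i).2

theorem tendsto_remainder [l.IsCountablyGenerated] (h : IsLocalizingFamily l W u κ M) :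
    Tendsto (fun i => ∫ x in Ioi 0, remainder (u i) (deriv (u i)) x ^ 2) l (𝓝 0) :=
  squeeze_zero (fun i => integral_nonneg fun x => sq_nonneg _)
    (fun i => by linarith [h.nonlocalForm_nonneg i]) h.tendsto_remainder_add

theorem tendsto_nonlocalForm [l.IsCountablyGenerated] (h : IsLocalizingFamily l W u κ M) :
    Tendsto (fun i => nonlocalForm (W i) (deficitGap (u i)) (deficitGap (u i))) l (𝓝 0) := by
  have h2 := h.tendsto_remainder_add.const_mul 4
  rw [mul_zero] at h2
  refine squeeze_zero (fun i => h.nonlocalForm_nonneg i) (fun i => ?_) h2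
  have : 0 ≤ ∫ x in Ioi 0, remainder (u i) (deriv (u i)) x ^ 2 :=
    integral_nonneg fun x => sq_nonneg _
  linarith

theorem tendsto_integral_deficitGap_mul [l.IsCountablyGenerated]
    (h : IsLocalizingFamily l W u κ M) :
    Tendsto (fun i => ∫ x, deficitGap (u i) x * deficit 𝐰 x) l (𝓝 0) := by
  obtain ⟨C, hC⟩ := h.exists_bound
  set G : ℝ := ∫ x, deficit 𝐰 x ^ 2 with hG
  have hG0 : 0 ≤ G := integral_nonneg fun x => sq_nonneg _
  have hgap : ∀ i, ∫ x, deficitGap (u i) x ^ 2 ≤ 2 * C + 2 * G := fun i => by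
    have i1 := (h.soliton i).isBCL2_deficit.memLp.integrable_sq
    have i2 := isBCL2_deficit_localBlackSoliton.memLp.integrable_sq
    calc _ ≤ ∫ x, (2 * deficit (u i) x ^ 2 + 2 * deficit 𝐰 x ^ 2) := by
          refine integral_mono (h.soliton i).isBCL2_deficitGap.memLp.integrable_sq
            ((i1.const_mul 2).add (i2.const_mul 2)) fun x => ?_
          simp only [deficitGap]
          nlinarith [sq_nonneg (deficit (u i) x + deficit 𝐰 x)]
      _ ≤ _ := by
          rw [integral_add (i1.const_mul 2) (i2.const_mul 2), integral_const_mul,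
            integral_const_mul]
          linarith [(hC i).2]
  have hlim : Tendsto (fun i => √(nonlocalForm (W i) (deficitGap (u i)) (deficitGap (u i)) *
      (M * G)) + √(2 * C + 2 * G) * symbolError (W i)) l (𝓝 0) := by
    have h1 := (Real.continuous_sqrt.tendsto _).comp (h.tendsto_nonlocalForm.mul_const (M * G))
    have h2 := h.tendsto_symbolError.const_mul (√(2 * C + 2 * G))
    simpa using h1.add h2
  refine squeeze_zero_norm (fun i => ?_) hlim
  refine ((h.soliton i).abs_integral_deficitGap_mul_le (h.lower i) le_rfl).trans ?_
  have h3 : 0 ≤ symbolError (W i) := Real.sqrt_nonneg _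
  refine add_le_add (Real.sqrt_le_sqrt ?_) (mul_le_mul_of_nonneg_right
    (Real.sqrt_le_sqrt (hgap i)) h3)
  refine mul_le_mul_of_nonneg_left ?_ (h.nonlocalForm_nonneg i)
  refine (nonlocalForm_self_le (W i) isBCL2_deficit_localBlackSoliton).trans ?_
  exact mul_le_mul_of_nonneg_right (real_univ_add_le (h.tvNorm_le i)) hG0

/-- The quotient `u / 𝐰` varies little on compact subsets of `(0, ∞)`. -/
theorem abs_ratio_sub_le {W : SignedMeasure ℝ} {u : ℝ → ℝ} {Q : ℝ} (h : IsOddMinimizerSoliton W u)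
    (hQ : ∀ x > 0, |u x| ≤ Q * 𝐰 x) {x y : ℝ} (hx : 0 < x) (hxy : x ≤ y) :
    |u y / 𝐰 y - u x / 𝐰 x| ≤ √(∫ t in Ioc x y, (𝐰 t)⁻¹ ^ 2) *
      √(∫ t in Ioi 0, remainder u (deriv u) t ^ 2) := by
  have hpos : ∀ t ∈ Icc x y, 0 < t := fun t ht => hx.trans_le ht.1
  -- The quotient rule gives (u/𝐰)' = (u' - (𝐰'/𝐰) u)/𝐰, so the L² norm of the remainder controls
  -- the oscillation of u/𝐰.
  have hd : ∀ t ∈ Icc x y, HasDerivAt (fun t => u t / 𝐰 t)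
      ((𝐰 t)⁻¹ * remainder u (deriv u) t) t := fun t ht => by
    have hw := localBlackSoliton_pos (hpos t ht)
    refine ((h.hasDerivAt t).div (hasDerivAt_localBlackSoliton t) hw.ne').congr_deriv ?_
    rw [remainder, logDerivSoliton]
    field_simp
  have hcw : ContinuousOn (fun t => (𝐰 t)⁻¹) (Icc x y) :=
    continuous_localBlackSoliton.continuousOn.inv₀ fun t ht =>
      (localBlackSoliton_pos (hpos t ht)).ne'
  have hcr : ContinuousOn (remainder u (deriv u)) (Icc x y) := by
    have hca : ContinuousOn logDerivSoliton (Icc x y) := fun t ht =>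
      (hasDerivAt_logDerivSoliton (hpos t ht)).continuousAt.continuousWithinAt
    exact h.continuous_deriv.continuousOn.sub (hca.mul h.mem.continuous.continuousOn)
  have h1 : u y / 𝐰 y - u x / 𝐰 x = ∫ t in Ioc x y, (𝐰 t)⁻¹ * remainder u (deriv u) t := by
    rw [← intervalIntegral.integral_of_le hxy]
    refine (intervalIntegral.integral_eq_sub_of_hasDerivAt (f := fun t => u t / 𝐰 t)
      (fun t ht => hd t ?_) ?_).symm
    · rwa [uIcc_of_le hxy] at ht
    · refine ContinuousOn.intervalIntegrable ?_
      rw [uIcc_of_le hxy]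
      exact hcw.mul hcr
  have hsub : Ioc x y ⊆ Ioi 0 := fun t ht => hx.trans ht.1
  have hLr := memLp_remainder h.mem.continuous h.memLp_deriv hQ
  have hLw : MemLp (fun t => (𝐰 t)⁻¹) 2 (volume.restrict (Ioc x y)) := by
    refine MemLp.of_bound ((hcw.mono Ioc_subset_Icc_self).aestronglyMeasurable measurableSet_Ioc)
      (𝐰 x)⁻¹ ((ae_restrict_iff' measurableSet_Ioc).2 (Eventually.of_forall fun t ht => ?_))
    have hwx := localBlackSoliton_pos hx
    have hwt := strictMono_localBlackSoliton.monotone ht.1.le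
    rw [Real.norm_of_nonneg (inv_nonneg.2 (hwx.le.trans hwt))]
    gcongr
  rw [h1]
  refine (abs_integral_mul_le hLw (hLr.mono_measure (Measure.restrict_mono hsub le_rfl))).trans ?_
  refine mul_le_mul_of_nonneg_left (Real.sqrt_le_sqrt ?_) (Real.sqrt_nonneg _)
  exact setIntegral_mono_set hLr.integrable_sq (Eventually.of_forall fun x => sq_nonneg _)
    hsub.eventuallyLE

theorem tendsto_ratio_sub [l.IsCountablyGenerated] (h : IsLocalizingFamily l W u κ M) {x : ℝ}
    (hx : 0 < x) : Tendsto (fun i => u i x / 𝐰 x - u i 1 / 𝐰 1) l (𝓝 0) := by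
  obtain ⟨Q, hQ⟩ := h.exists_ratio_bound
  have hr : Tendsto (fun i => √(∫ t in Ioi 0, remainder (u i) (deriv (u i)) t ^ 2)) l (𝓝 0) := by
    have := (Real.continuous_sqrt.tendsto _).comp h.tendsto_remainder
    rwa [Real.sqrt_zero] at this
  rcases le_total 1 x with h1 | h1
  · refine squeeze_zero_norm (fun i => abs_ratio_sub_le (h.soliton i) (hQ i) one_pos h1) ?_
    have := hr.const_mul (√(∫ t in Ioc 1 x, (𝐰 t)⁻¹ ^ 2))
    rwa [mul_zero] at this
  · refine squeeze_zero_norm (fun i => ?_) (a := fun i => √(∫ t in Ioc x 1, (𝐰 t)⁻¹ ^ 2) *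
      √(∫ t in Ioi 0, remainder (u i) (deriv (u i)) t ^ 2)) ?_
    · rw [Real.norm_eq_abs, abs_sub_comm]
      exact abs_ratio_sub_le (h.soliton i) (hQ i) hx h1
    · have := hr.const_mul (√(∫ t in Ioc x 1, (𝐰 t)⁻¹ ^ 2))
      rwa [mul_zero] at this

theorem abs_ratio_le {f : ℝ → ℝ} {Q x : ℝ} (hQ : ∀ x > 0, |f x| ≤ Q * 𝐰 x) (hx : 0 < x) :
    |f x / 𝐰 x| ≤ Q := by
  have hw := localBlackSoliton_pos hx
  rw [abs_div, abs_of_pos hw, div_le_iff₀ hw]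
  exact hQ x hx

theorem tendsto_ratio_sq_sub [l.IsCountablyGenerated] (h : IsLocalizingFamily l W u κ M) {x : ℝ}
    (hx : 0 < x) : Tendsto (fun i => (u i x / 𝐰 x) ^ 2 - (u i 1 / 𝐰 1) ^ 2) l (𝓝 0) := by
  obtain ⟨Q, hQ⟩ := h.exists_ratio_bound
  have h1 := (h.tendsto_ratio_sub hx).abs.const_mul (2 * Q)
  rw [abs_zero, mul_zero] at h1
  refine squeeze_zero_norm (fun i => ?_) h1
  rw [sq_sub_sq, Real.norm_eq_abs, abs_mul]
  gcongr
  refine (abs_add_le _ _).trans ?_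
  linarith [abs_ratio_le (hQ i) hx, abs_ratio_le (hQ i) one_pos]

/-- Writing 𝐰² - u² = 𝐰² (1 - (u/𝐰)²) turns the integral into an average of 1 - (u/𝐰)² with positive
weight; this fixes the value of the nearly constant ratio. -/
theorem integral_deficitGap_mul_eq {W : SignedMeasure ℝ} {u : ℝ → ℝ}
    (h : IsOddMinimizerSoliton W u) :
    ∫ x, deficitGap u x * deficit 𝐰 x =
      2 * ∫ x in Ioi 0, 𝐰 x ^ 2 * deficit 𝐰 x * (1 - (u x / 𝐰 x) ^ 2) := by
  rw [integral_even fun x => by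
    simp only [deficitGap_eq, h.mem.odd, localBlackSoliton_neg, deficit_localBlackSoliton_neg,
      neg_sq]]
  congr 1
  refine setIntegral_congr_fun measurableSet_Ioi fun x hx => ?_
  have hw := localBlackSoliton_pos hx
  simp only [deficitGap_eq]
  field_simp

/-- In the weighted average of 1 - (u/𝐰)², which tends to 0, dominated convergence allows the ratio
to be replaced by its value at 1. The total weight is positive, so the value can be solved for. -/
theorem tendsto_ratio_one_sq [l.IsCountablyGenerated] (h : IsLocalizingFamily l W u κ M) :
    Tendsto (fun i => (u i 1 / 𝐰 1) ^ 2) l (𝓝 1) := by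
  obtain ⟨Q, hQ⟩ := h.exists_ratio_bound
  let k : ℝ → ℝ := fun x => 𝐰 x ^ 2 * deficit 𝐰 x
  have hkc : Continuous k :=
    (continuous_localBlackSoliton.pow 2).mul (continuous_deficit continuous_localBlackSoliton)
  have hk0 : ∀ x, 0 ≤ k x := fun x =>
    mul_nonneg (sq_nonneg _) (deficit_localBlackSoliton_pos x).le
  have hkI : Integrable k := by
    have := integrable_deficit_mul_sq continuous_localBlackSoliton
      (fun x => (abs_localBlackSoliton_lt_one x).le)
    simpa only [k, mul_comm] using this
  have hI0 : 0 < ∫ x in Ioi 0, k x := by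
    rw [setIntegral_pos_iff_support_of_nonneg_ae (Eventually.of_forall hk0) hkI.integrableOn]
    have : Ioi 0 ⊆ Function.support k ∩ Ioi 0 := fun x hx => ⟨by
      have hw := localBlackSoliton_pos hx
      have hg := deficit_localBlackSoliton_pos x
      exact (by positivity : 0 < k x).ne', hx⟩
    exact lt_of_lt_of_le (by simp) (measure_mono this)
  have hdct : Tendsto (fun i => ∫ x in Ioi 0, k x * ((u i 1 / 𝐰 1) ^ 2 - (u i x / 𝐰 x) ^ 2)) l
      (𝓝 0) := by
    have e0 : 𝓝 (0 : ℝ) = 𝓝 (∫ _ in Ioi (0 : ℝ), (0 : ℝ)) := by simp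
    rw [e0]
    refine tendsto_integral_filter_of_dominated_convergence (fun x => k x * (2 * Q ^ 2))
      (Eventually.of_forall fun i => ?_) (Eventually.of_forall fun i => ?_)
      (hkI.integrableOn.mul_const _) ?_
    · exact (hkc.measurable.mul (measurable_const.sub (((h.soliton i).mem.continuous.measurable.div
        continuous_localBlackSoliton.measurable).pow_const 2))).aestronglyMeasurable
    · refine (ae_restrict_iff' measurableSet_Ioi).2 (Eventually.of_forall fun x hx => ?_)
      rw [norm_mul, Real.norm_of_nonneg (hk0 x), Real.norm_eq_abs]
      refine mul_le_mul_of_nonneg_left ?_ (hk0 x)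
      have h1 := sq_le_sq' (abs_le.1 (abs_ratio_le (hQ i) one_pos)).1
        (abs_le.1 (abs_ratio_le (hQ i) one_pos)).2
      have h2 := sq_le_sq' (abs_le.1 (abs_ratio_le (hQ i) hx)).1
        (abs_le.1 (abs_ratio_le (hQ i) hx)).2
      rw [abs_le]
      constructor <;> nlinarith [sq_nonneg (u i 1 / 𝐰 1), sq_nonneg (u i x / 𝐰 x)]
    · refine (ae_restrict_iff' measurableSet_Ioi).2 (Eventually.of_forall fun x hx => ?_)
      have := (h.tendsto_ratio_sq_sub hx).neg.const_mul (k x)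
      simpa using this
  have hgap : Tendsto (fun i => ∫ x in Ioi 0, k x * (1 - (u i x / 𝐰 x) ^ 2)) l (𝓝 0) := by
    have := h.tendsto_integral_deficitGap_mul.const_mul (1 / 2)
    rw [mul_zero] at this
    refine this.congr fun i => ?_
    rw [integral_deficitGap_mul_eq (h.soliton i)]
    ring
  have hkr : ∀ i, IntegrableOn (fun x => k x * (u i x / 𝐰 x) ^ 2) (Ioi 0) := fun i => by
    refine Integrable.mul_bdd (c := Q ^ 2) hkI.integrableOn
      (((h.soliton i).mem.continuous.measurable.div
        continuous_localBlackSoliton.measurable).pow_const 2).aestronglyMeasurable ?_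
    refine (ae_restrict_iff' measurableSet_Ioi).2 (Eventually.of_forall fun x hx => ?_)
    rw [norm_pow]
    exact pow_le_pow_left₀ (norm_nonneg _) (abs_ratio_le (hQ i) hx) 2
  have hprod : Tendsto (fun i => (1 - (u i 1 / 𝐰 1) ^ 2) * ∫ x in Ioi 0, k x) l (𝓝 0) := by
    have := hgap.sub hdct
    rw [sub_zero] at this
    refine this.congr fun i => ?_
    simp only [mul_sub, mul_one]
    rw [integral_sub hkI.integrableOn (hkr i),
      integral_sub (hkI.integrableOn.mul_const _) (hkr i), integral_mul_const]
    ring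
  have := (hprod.div_const (∫ x in Ioi 0, k x)).const_sub 1
  rw [zero_div, sub_zero] at this
  refine this.congr fun i => ?_
  rw [mul_div_cancel_right₀ _ hI0.ne']
  ring

theorem tendsto_ratio_sq [l.IsCountablyGenerated] (h : IsLocalizingFamily l W u κ M) {x : ℝ}
    (hx : 0 < x) : Tendsto (fun i => (u i x / 𝐰 x) ^ 2) l (𝓝 1) := by
  simpa using (h.tendsto_ratio_sq_sub hx).add h.tendsto_ratio_one_sq

/-- A dominated convergence statement for products with the logarithmic derivative. -/
theorem tendsto_integral_logDerivSoliton_mul_sq [l.IsCountablyGenerated] {f : ι → ℝ → ℝ} {A : ℝ}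
    (hf : ∀ i, Continuous (f i)) (hA : ∀ i, ∀ x > 0, |f i x| ≤ A * 𝐰 x)
    (hlim : ∀ x > 0, Tendsto (fun i => f i x) l (𝓝 0)) :
    Tendsto (fun i => ∫ x in Ioi 0, (logDerivSoliton x * f i x) ^ 2) l (𝓝 0) := by
  have e0 : 𝓝 (0 : ℝ) = 𝓝 (∫ _ in Ioi (0 : ℝ), (0 : ℝ)) := by simp
  rw [e0]
  refine tendsto_integral_filter_of_dominated_convergence
    (fun x => A ^ 2 * (deficit 𝐰 x / √2) ^ 2)
    (Eventually.of_forall fun i => ?_) (Eventually.of_forall fun i => ?_)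
    (memLp_deriv_localBlackSoliton.integrable_sq.integrableOn.const_mul _) ?_
  · exact ((measurable_logDerivSoliton.mul (hf i).measurable).pow_const 2).aestronglyMeasurable
  · refine (ae_restrict_iff' measurableSet_Ioi).2 (Eventually.of_forall fun x hx => ?_)
    rw [norm_pow, ← mul_pow]
    exact pow_le_pow_left₀ (norm_nonneg _) (abs_logDerivSoliton_mul_le (hA i) hx) 2
  · refine (ae_restrict_iff' measurableSet_Ioi).2 (Eventually.of_forall fun x hx => ?_)
    have := ((hlim x hx).const_mul (logDerivSoliton x)).pow 2
    simpa using this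

end IsLocalizingFamily

/-- The derivative of `deficitGap u`. -/
def deficitGapDeriv (u : ℝ → ℝ) (x : ℝ) : ℝ :=
  -(2 * u x * deriv u x) + -1 * -(2 * 𝐰 x * (deficit 𝐰 x / √2))

/-! ### Derivative of the gap and sign of the soliton -/

namespace IsOddMinimizerSoliton

variable {W : SignedMeasure ℝ} {u : ℝ → ℝ}

theorem hasDerivAt_deficitGap (h : IsOddMinimizerSoliton W u) (x : ℝ) :
    HasDerivAt (deficitGap u) (deficitGapDeriv u x) x :=
  (h.hasDerivAt_deficit x).add ((hasDerivAt_deficit_localBlackSoliton x).const_mul (-1))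

theorem continuous_deficitGapDeriv (h : IsOddMinimizerSoliton W u) :
    Continuous (deficitGapDeriv u) := by
  have h1 := h.mem.continuous
  have h2 := h.continuous_deriv
  have h3 := continuous_localBlackSoliton
  have h4 := continuous_deficit h3
  unfold deficitGapDeriv
  fun_prop

theorem memLp_deficitGapDeriv (h : IsOddMinimizerSoliton W u) :
    MemLp (deficitGapDeriv u) 2 volume := by
  have h1 := (memLp_mul_of_bounded h.mem.continuous h.bounded h.memLp_deriv).const_mul (-2)
  have h2 := (memLp_mul_of_bounded continuous_localBlackSoliton
    ⟨1, fun x => (abs_localBlackSoliton_lt_one x).le⟩ memLp_deriv_localBlackSoliton).const_mul 2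
  refine (h1.add h2).ae_eq (Eventually.of_forall fun x => ?_)
  simp only [deficitGapDeriv, Pi.add_apply]
  ring

theorem deficitGapDeriv_neg_sq (h : IsOddMinimizerSoliton W u) (x : ℝ) :
    deficitGapDeriv u (-x) ^ 2 = deficitGapDeriv u x ^ 2 := by
  simp only [deficitGapDeriv, h.mem.odd, h.deriv_neg, localBlackSoliton_neg,
    deficit_localBlackSoliton_neg]
  ring

/-- Substitute u' = r + (𝐰'/𝐰) u. The first term is handled by dominated convergence and the second
by the smallness of the remainder r, so no bound on u' - 𝐰' is needed. -/
theorem deficitGapDeriv_eq {x : ℝ} (hx : 0 < x) : deficitGapDeriv u x =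
    2 * (logDerivSoliton x * deficitGap u x) - 2 * (u x * remainder u (deriv u) x) := by
  have hw := localBlackSoliton_pos hx
  rw [deficitGap_eq, deficitGapDeriv, remainder, logDerivSoliton]
  field_simp
  ring

theorem tendsto_deficitGap_atBot (h : IsOddMinimizerSoliton W u) :
    Tendsto (deficitGap u) atBot (𝓝 0) := by
  have := h.tendsto_deficit_atBot.add (tendsto_deficit_localBlackSoliton_atBot.const_mul (-1))
  rwa [mul_zero, add_zero] at this

/-- A soliton whose square is close to that of the local black soliton is positive. -/
theorem pos_of_abs_deficitGap_lt (h : IsOddMinimizerSoliton W u) {δ : ℝ} (hδ : 0 < δ)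
    (hgap : ∀ x, |deficitGap u x| < 𝐰 δ ^ 2) {x : ℝ} (hx : δ ≤ x) : 0 < u x := by
  -- At a zero of `u` the gap equals 𝐰(y)² ≥ 𝐰(δ)². Having no zero beyond δ and the limit 1 at
  -- infinity, `u` stays positive there by the intermediate value theorem.
  have hne : ∀ y ≥ δ, u y ≠ 0 := fun y hy h0 => by
    have h1 := hgap y
    rw [deficitGap_eq, h0] at h1
    have h2 := localBlackSoliton_pos hδ
    have h3 := strictMono_localBlackSoliton.monotone hy
    have h4 : 𝐰 δ ^ 2 ≤ 𝐰 y ^ 2 := by gcongr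
    have h5 := (abs_lt.1 h1).2
    linarith
  by_contra hneg
  obtain ⟨y, hy1, hy2⟩ := ((h.tendsto_atTop.eventually (lt_mem_nhds zero_lt_one)).and
    (eventually_ge_atTop x)).exists
  obtain ⟨z, hz, hz0⟩ := intermediate_value_Icc hy2 h.mem.continuous.continuousOn
    ⟨not_lt.1 hneg, hy1.le⟩
  exact hne z (hx.trans hz.1) hz0

end IsOddMinimizerSoliton

/-! ### Convergence of the gap, of the solitons and of their derivatives -/

namespace IsLocalizingFamily

variable {ι : Type*} {l : Filter ι} {W : ι → SignedMeasure ℝ} {u : ι → ℝ → ℝ} {κ : ℝ} {M : NNReal}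

theorem tendsto_deficitGap [l.IsCountablyGenerated] (h : IsLocalizingFamily l W u κ M) {x : ℝ}
    (hx : 0 < x) : Tendsto (fun i => deficitGap (u i) x) l (𝓝 0) := by
  have h1 := ((h.tendsto_ratio_sq hx).const_sub 1).const_mul (𝐰 x ^ 2)
  rw [sub_self, mul_zero] at h1
  refine h1.congr fun i => ?_
  have hw := localBlackSoliton_pos hx
  rw [deficitGap_eq]
  field_simp

theorem tendsto_integral_deficitGapDeriv_sq [l.IsCountablyGenerated]
    (h : IsLocalizingFamily l W u κ M) :
    Tendsto (fun i => ∫ x, deficitGapDeriv (u i) x ^ 2) l (𝓝 0) := by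
  obtain ⟨C, hC⟩ := h.exists_bound
  obtain ⟨Q, hQ⟩ := h.exists_ratio_bound
  have hgapw : ∀ i, ∀ x > 0, |deficitGap (u i) x| ≤ (1 + C * Q) * 𝐰 x := fun i x hx => by
    have hw := localBlackSoliton_pos hx
    have hw1 := (abs_lt.1 (abs_localBlackSoliton_lt_one x)).2
    have hC0 : 0 ≤ C := (abs_nonneg _).trans ((hC i).1 0)
    rw [deficitGap_eq]
    calc _ ≤ |𝐰 x ^ 2| + |u i x ^ 2| := abs_sub _ _
      _ = 𝐰 x * 𝐰 x + |u i x| * |u i x| := by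
        rw [abs_pow, abs_pow, abs_of_pos hw]; ring
      _ ≤ 1 * 𝐰 x + C * (Q * 𝐰 x) := by
        gcongr
        · exact (hC i).1 x
        · exact hQ i x hx
      _ = _ := by ring
  have h1 := tendsto_integral_logDerivSoliton_mul_sq (l := l)
    (fun i => (h.soliton i).isBCL2_deficitGap.continuous) hgapw fun x hx => h.tendsto_deficitGap hx
  -- The 8 comes from (2A - 2B)² ≤ 8A² + 8B², the C² from |u| ≤ C, and the outer 2 from evenness.
  have hlim := ((h1.const_mul 8).add (h.tendsto_remainder.const_mul (8 * C ^ 2))).const_mul 2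
  simp only [mul_zero, add_zero] at hlim
  refine squeeze_zero (fun i => integral_nonneg fun x => sq_nonneg _) (fun i => ?_) hlim
  rw [integral_even (f := fun x => deficitGapDeriv (u i) x ^ 2)
    (h.soliton i).deficitGapDeriv_neg_sq]
  have hI1 := (memLp_logDerivSoliton_mul (h.soliton i).isBCL2_deficitGap.continuous
    (hgapw i)).integrable_sq
  have hI2 := (memLp_remainder (h.soliton i).mem.continuous (h.soliton i).memLp_deriv
    (hQ i)).integrable_sq
  refine mul_le_mul_of_nonneg_left ?_ zero_le_two
  rw [← integral_const_mul, ← integral_const_mul, ← integral_add (hI1.const_mul _)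
    (hI2.const_mul _)]
  refine setIntegral_mono_on (h.soliton i).memLp_deficitGapDeriv.integrable_sq.integrableOn
    ((hI1.const_mul _).add (hI2.const_mul _)) measurableSet_Ioi fun x hx => ?_
  rw [IsOddMinimizerSoliton.deficitGapDeriv_eq hx]
  have h2 : u i x ^ 2 ≤ C ^ 2 := sq_le_sq' (abs_le.1 ((hC i).1 x)).1 (abs_le.1 ((hC i).1 x)).2
  have h3 : (u i x * remainder (u i) (deriv (u i)) x) ^ 2 ≤
      C ^ 2 * remainder (u i) (deriv (u i)) x ^ 2 := by
    rw [mul_pow]; gcongr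
  show _ ≤ 8 * _ + 8 * C ^ 2 * _
  nlinarith [sq_nonneg (logDerivSoliton x * deficitGap (u i) x +
    u i x * remainder (u i) (deriv (u i)) x)]

/-- The lower bound on Ŵ controls the L² norm by the form, up to κ times the derivative term, and
both are already known to vanish in the limit. -/
theorem tendsto_integral_deficitGap_sq [l.IsCountablyGenerated]
    (h : IsLocalizingFamily l W u κ M) :
    Tendsto (fun i => ∫ x, deficitGap (u i) x ^ 2) l (𝓝 0) := by
  have hlim := h.tendsto_nonlocalForm.add (h.tendsto_integral_deficitGapDeriv_sq.const_mul κ)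
  rw [mul_zero, add_zero] at hlim
  exact squeeze_zero (fun i => integral_nonneg fun x => sq_nonneg _) (fun i =>
    integral_sq_le_nonlocalForm_add h.nonneg (h.lower i) (h.soliton i).isBCL2_deficitGap
      (h.soliton i).hasDerivAt_deficitGap (h.soliton i).continuous_deficitGapDeriv
      (h.soliton i).memLp_deficitGapDeriv) hlim

theorem eventually_abs_deficitGap_lt [l.IsCountablyGenerated]
    (h : IsLocalizingFamily l W u κ M) {ε : ℝ} (hε : 0 < ε) :
    ∀ᶠ i in l, ∀ x, |deficitGap (u i) x| < ε := by
  have h1 := (Real.continuous_sqrt.tendsto _).comp h.tendsto_integral_deficitGap_sq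
  have h2 := (Real.continuous_sqrt.tendsto _).comp h.tendsto_integral_deficitGapDeriv_sq
  have h3 := (h1.mul h2).const_mul 2
  simp only [Real.sqrt_zero, mul_zero] at h3
  filter_upwards [h3.eventually (gt_mem_nhds (pow_pos hε 2))] with i hi x
  refine abs_lt_of_sq_lt_sq ?_ hε.le
  exact (sq_le_two_mul_sqrt_mul_sqrt (h.soliton i).hasDerivAt_deficitGap
    (h.soliton i).isBCL2_deficitGap.memLp (h.soliton i).memLp_deficitGapDeriv
    (h.soliton i).tendsto_deficitGap_atBot x).trans_lt hi

/-- Uniform convergence to the local black soliton. -/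
theorem eventually_abs_sub_le [l.IsCountablyGenerated] (h : IsLocalizingFamily l W u κ M) :
    ∀ ε > 0, ∀ᶠ i in l, ∀ x, |u i x - 𝐰 x| ≤ ε := by
  intro ε hε
  obtain ⟨L, hL⟩ := exists_abs_le_mul_abs (h.uniformlyBddDeriv 1) fun i => (h.soliton i).map_zero
  obtain ⟨L', hL'⟩ := exists_abs_le_mul_abs (uniformlyBddDeriv_localBlackSoliton Unit 1)
    fun _ => localBlackSoliton_zero
  -- On [0, δ) both functions are small because they vanish at 0 with known Lipschitz constants;
  -- beyond δ their squares are compared.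
  set δ : ℝ := ε / (|L| + |L'| + 1) with hδdef
  have hδ : 0 < δ := by positivity
  have hδε : (|L| + |L'|) * δ ≤ ε := by
    calc (|L| + |L'|) * δ ≤ (|L| + |L'| + 1) * δ :=
          mul_le_mul_of_nonneg_right (by linarith) hδ.le
      _ = ε := by rw [hδdef]; field_simp
  have hw := localBlackSoliton_pos hδ
  -- The threshold 𝐰(δ)² yields positivity of `u` beyond δ. The threshold ε² yields closeness, since
  -- (a - b)² ≤ |a² - b²| for a, b ≥ 0.
  filter_upwards [h.eventually_abs_deficitGap_lt (ε := min (ε ^ 2) (𝐰 δ ^ 2))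
    (lt_min (by positivity) (by positivity))] with i hi
  have hpos : ∀ x ≥ 0, |u i x - 𝐰 x| ≤ ε := fun x hx => by
    rcases lt_or_ge x δ with hxδ | hxδ
    · calc |u i x - 𝐰 x| ≤ |u i x| + |𝐰 x| := abs_sub _ _
        _ ≤ L * |x| + L' * |x| := add_le_add (hL i x) (hL' () x)
        _ ≤ |L| * δ + |L'| * δ := by
          rw [abs_of_nonneg hx]
          gcongr
          · exact le_abs_self L
          · exact le_abs_self L'
        _ ≤ ε := by linarith
    · have hu := (h.soliton i).pos_of_abs_deficitGap_lt hδ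
        (fun x => (hi x).trans_le (min_le_right _ _)) hxδ
      have hwx := localBlackSoliton_pos (hδ.trans_le hxδ)
      refine abs_le_of_sq_le_sq ?_ hε.le
      have h1 := ((hi x).trans_le (min_le_left _ _)).le
      rw [deficitGap_eq] at h1
      obtain ⟨h2, h3⟩ := abs_le.1 h1
      rcases le_total (u i x) (𝐰 x) with h4 | h4 <;> nlinarith
  intro x
  rcases le_total 0 x with hx | hx
  · exact hpos x hx
  · have := hpos (-x) (by linarith)
    rw [(h.soliton i).mem.odd, localBlackSoliton_neg] at this
    rwa [← abs_neg, show -(-u i x - -𝐰 x) = u i x - 𝐰 x by ring] at this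

theorem tendsto_apply [l.IsCountablyGenerated] (h : IsLocalizingFamily l W u κ M) (x : ℝ) :
    Tendsto (fun i => u i x) l (𝓝 (𝐰 x)) := by
  rw [Metric.tendsto_nhds]
  intro ε hε
  filter_upwards [h.eventually_abs_sub_le (ε / 2) (half_pos hε)] with i hi
  rw [Real.dist_eq]
  linarith [hi x]

/-- Strong convergence of the derivatives in `L²`. -/
theorem tendsto_integral_deriv_sub_sq [l.IsCountablyGenerated] (h : IsLocalizingFamily l W u κ M) :
    Tendsto (fun i => ∫ x, (deriv (u i) x - deficit 𝐰 x / √2) ^ 2) l (𝓝 0) := by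
  obtain ⟨Q, hQ⟩ := h.exists_ratio_bound
  have hb : ∀ i, ∀ x > 0, |u i x - 𝐰 x| ≤ (Q + 1) * 𝐰 x := fun i x hx => by
    have hw := localBlackSoliton_pos hx
    refine (abs_sub _ _).trans ?_
    rw [abs_of_pos hw]
    linarith [hQ i x hx]
  have hc : ∀ i, Continuous fun x => u i x - 𝐰 x := fun i =>
    (h.soliton i).mem.continuous.sub continuous_localBlackSoliton
  have h1 := tendsto_integral_logDerivSoliton_mul_sq (l := l) hc hb fun x _ => by
    simpa using (h.tendsto_apply x).sub_const (𝐰 x)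
  have hlim := ((h.tendsto_remainder.const_mul 2).add (h1.const_mul 2)).const_mul 2
  simp only [mul_zero, add_zero] at hlim
  refine squeeze_zero (fun i => integral_nonneg fun x => sq_nonneg _) (fun i => ?_) hlim
  rw [integral_even (f := fun x => (deriv (u i) x - deficit 𝐰 x / √2) ^ 2) fun x => by
    rw [(h.soliton i).deriv_neg, deficit_localBlackSoliton_neg]]
  have hI1 := (memLp_remainder (h.soliton i).mem.continuous (h.soliton i).memLp_deriv
    (hQ i)).integrable_sq
  have hI2 := (memLp_logDerivSoliton_mul (hc i) (hb i)).integrable_sq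
  refine mul_le_mul_of_nonneg_left ?_ zero_le_two
  rw [← integral_const_mul, ← integral_const_mul, ← integral_add (hI1.const_mul _)
    (hI2.const_mul _)]
  refine setIntegral_mono_on
    ((h.soliton i).memLp_deriv.sub memLp_deriv_localBlackSoliton).integrable_sq.integrableOn
    ((hI1.const_mul _).add (hI2.const_mul _)) measurableSet_Ioi fun x hx => ?_
  have hw := localBlackSoliton_pos hx
  -- Since the remainder of 𝐰 is zero, u' - 𝐰' is the remainder of `u` plus (𝐰'/𝐰)(u - 𝐰); the
  -- latter tends to 0 in L² by dominated convergence.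
  have e : deriv (u i) x - deficit 𝐰 x / √2 =
      remainder (u i) (deriv (u i)) x + logDerivSoliton x * (u i x - 𝐰 x) := by
    rw [remainder, logDerivSoliton]
    field_simp
    ring
  rw [e]
  show _ ≤ 2 * _ + 2 * _
  nlinarith [sq_nonneg (remainder (u i) (deriv (u i)) x - logDerivSoliton x * (u i x - 𝐰 x))]

theorem eventually_iteratedDeriv_sub_le [l.IsCountablyGenerated]
    (h : IsLocalizingFamily l W u κ M) (j : ℕ) : ∀ ε > 0, ∀ᶠ i in l, ∀ x,
      |iteratedDeriv j (u i) x - iteratedDeriv j 𝐰 x| ≤ ε := by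
  have hw := uniformlyBddDeriv_localBlackSoliton ι
  have hd : UniformlyBddDeriv (j + 1) fun i x => u i x + (0 - 1 * 𝐰 x) :=
    (h.uniformlyBddDeriv (j + 1)).add ((hw (j + 1)).const_sub_mul 0 1)
  have e : (fun i x => u i x + (0 - 1 * 𝐰 x)) = fun i x => u i x - 𝐰 x := by
    ext i x; ring
  rw [e] at hd
  intro ε hε
  filter_upwards [UniformlyBddDeriv.eventually_iteratedDeriv j hd h.eventually_abs_sub_le ε hε]
    with i hi x
  have h1 := ((h.uniformlyBddDeriv j).contDiff i).contDiffAt (x := x)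
  have h2 := ((hw j).contDiff i).contDiffAt (x := x)
  rw [← iteratedDeriv_fun_sub h1 h2]
  exact hi x

theorem tendsto_eLpNorm [l.IsCountablyGenerated] (h : IsLocalizingFamily l W u κ M) (k : ℕ)
    (R : ℝ) : Tendsto (fun i => ∑ j ∈ Finset.range (k + 1),
        eLpNorm (fun x => iteratedDeriv j (u i) x - iteratedDeriv j 𝐰 x) ∞
          (volume.restrict (Ioo (-R) R))) l (𝓝 0) := by
  rw [show 𝓝 (0 : ℝ≥0∞) = 𝓝 (∑ j ∈ Finset.range (k + 1), 0) by simp]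
  refine tendsto_finsetSum _ fun j _ => ?_
  rw [ENNReal.tendsto_nhds_zero]
  intro ε hε
  rcases eq_or_ne ε ∞ with rfl | hε'
  · simp
  filter_upwards [h.eventually_iteratedDeriv_sub_le j ε.toReal (ENNReal.toReal_pos hε.ne' hε')]
    with i hi
  rw [eLpNorm_exponent_top]
  refine (eLpNormEssSup_le_of_ae_bound (Eventually.of_forall hi)).trans_eq ?_
  exact ENNReal.ofReal_toReal hε'

theorem tendsto_integral_mul [l.IsCountablyGenerated] (h : IsLocalizingFamily l W u κ M)
    {φ : ℝ → ℝ} (hφ : Integrable φ) :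
    Tendsto (fun i => ∫ x, u i x * φ x) l (𝓝 (∫ x, 𝐰 x * φ x)) := by
  obtain ⟨C, hC⟩ := h.exists_bound
  refine tendsto_integral_filter_of_dominated_convergence (fun x => C * ‖φ x‖)
    (Eventually.of_forall fun i => (h.soliton i).mem.continuous.aestronglyMeasurable.mul hφ.1)
    (Eventually.of_forall fun i => Eventually.of_forall fun x => ?_) (hφ.norm.const_mul C)
    (Eventually.of_forall fun x => (h.tendsto_apply x).mul_const _)
  rw [norm_mul]
  gcongr
  exact (hC i).1 x

theorem tendsto_integral_weakDeriv_mul [l.IsCountablyGenerated] (h : IsLocalizingFamily l W u κ M)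
    {φ : ℝ → ℝ} (hφ : MemLp φ 2 volume) :
    Tendsto (fun i => ∫ x, weakDeriv (u i) x * φ x) l (𝓝 (∫ x, weakDeriv 𝐰 x * φ x)) := by
  rw [← tendsto_sub_nhds_zero_iff]
  have hlim := ((Real.continuous_sqrt.tendsto _).comp h.tendsto_integral_deriv_sub_sq).mul_const
    (√(∫ x, φ x ^ 2))
  rw [Real.sqrt_zero, zero_mul] at hlim
  refine squeeze_zero_norm (fun i => ?_) hlim
  have hL := (h.soliton i).memLp_deriv.sub memLp_deriv_localBlackSoliton
  have e : (∫ x, weakDeriv (u i) x * φ x) - ∫ x, weakDeriv 𝐰 x * φ x =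
      ∫ x, (deriv (u i) x - deficit 𝐰 x / √2) * φ x := by
    rw [← integral_sub (MemLp.integrable_mul_two (h.soliton i).mem.weakDeriv_memLp hφ)
      (MemLp.integrable_mul_two memEnergyOdd_localBlackSoliton.weakDeriv_memLp hφ)]
    refine integral_congr_ae ?_
    filter_upwards [(h.soliton i).weakDeriv_ae, weakDeriv_localBlackSoliton_ae] with x h1 h2
    rw [h1, h2, sub_mul]
  rw [e]
  exact abs_integral_mul_le hL hφ

end IsLocalizingFamily

end NonlocalGP

end

/-! ### The local limit as λ → 0⁺ -/

theorem theorem1p6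
    (lamStar : ℝ) (hlamStar : 0 < lamStar)
    (W : ℝ → MeasureTheory.SignedMeasure ℝ)
    (hW : ∀ lam ∈ Set.Ioo 0 lamStar, NonlocalGP.IsNormalizedPotential (W lam))
    (κ : ℝ) (hκ : 0 ≤ κ)
    (hlower : ∀ lam ∈ Set.Ioo 0 lamStar, NonlocalGP.FourierLowerBound (W lam) κ)
    (hconv : ∃ α : ℝ, 0 ≤ α ∧ ∀ᵐ ξ : ℝ,
      Filter.Tendsto (fun lam => NonlocalGP.fourierMeasure (NonlocalGP.jordanPos (W lam)) ξ)
        (nhdsWithin 0 (Set.Ioi 0)) (nhds ((1 + α : ℝ) : ℂ)) ∧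
      Filter.Tendsto (fun lam => NonlocalGP.fourierMeasure (NonlocalGP.jordanNeg (W lam)) ξ)
        (nhdsWithin 0 (Set.Ioi 0)) (nhds (α : ℂ)))
    (hbdd : ∃ M : NNReal, ∀ lam ∈ Set.Ioo 0 lamStar, NonlocalGP.tvNorm (W lam) ≤ M)
    (u : ℝ → ℝ → ℝ)
    (hu : ∀ lam ∈ Set.Ioo 0 lamStar, NonlocalGP.IsOddMinimizerSoliton (W lam) (u lam)) :
    (∀ k : ℕ, NonlocalGP.TendstoWkInftyLoc k u (nhdsWithin 0 (Set.Ioi 0))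
      NonlocalGP.localBlackSoliton) ∧
    NonlocalGP.TendstoWeakStarLInfty u (nhdsWithin 0 (Set.Ioi 0))
      NonlocalGP.localBlackSoliton ∧
    NonlocalGP.TendstoWeakHomSobolev u (nhdsWithin 0 (Set.Ioi 0))
      NonlocalGP.localBlackSoliton := by
  obtain ⟨M, hM⟩ := hbdd
  obtain ⟨α, -, hα⟩ := hconv
  have hmem : Ioo 0 lamStar ∈ 𝓝[>] (0 : ℝ) := Ioo_mem_nhdsGT hlamStar
  -- The solitons are only given for λ in (0, λ*), so the family is indexed by that interval. As it
  -- is a right neighbourhood of 0, limits along the pulled-back filter are the limits as λ → 0⁺.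
  have htend : ∀ {β : Type} {F : ℝ → β} {m : Filter β},
      Tendsto (fun i : Ioo 0 lamStar => F i) (comap Subtype.val (𝓝[>] 0)) m ↔
        Tendsto F (𝓝[>] 0) m := fun {β F m} => by
    have h1 : map (Subtype.val : Ioo 0 lamStar → ℝ) (comap Subtype.val (𝓝[>] 0)) = 𝓝[>] 0 :=
      map_comap_of_mem (by rwa [Subtype.range_coe])
    conv_rhs => rw [← h1, tendsto_map'_iff]
    rfl
  have hfam : NonlocalGP.IsLocalizingFamily (comap Subtype.val (𝓝[>] 0))
      (fun i : Ioo 0 lamStar => W i) (fun i => u i) κ M :=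
    { nonneg := hκ
      lower := fun i => hlower i i.2
      tvNorm_le := fun i => hM i i.2
      soliton := fun i => hu i i.2
      tendsto_fourier := by
        refine ⟨α, ?_⟩
        filter_upwards [hα] with ξ hξ
        exact ⟨htend.2 hξ.1, htend.2 hξ.2⟩ }
  refine ⟨fun k => ⟨?_, ?_, fun R _ => htend.1 (hfam.tendsto_eLpNorm k R)⟩,
    ⟨?_, ?_, fun φ hφ => htend.1 (hfam.tendsto_integral_mul hφ)⟩,
    ⟨?_, ?_, fun φ hφ => htend.1 (hfam.tendsto_integral_weakDeriv_mul hφ)⟩⟩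
  · filter_upwards [hmem] with lam hlam
    exact (hfam.uniformlyBddDeriv k).contDiff ⟨lam, hlam⟩
  · exact (NonlocalGP.uniformlyBddDeriv_localBlackSoliton Unit k).contDiff ()
  · filter_upwards [hmem] with lam hlam
    obtain ⟨C, hC⟩ := (hu lam hlam).bounded
    exact memLp_top_of_bound (hu lam hlam).mem.continuous.aestronglyMeasurable C
      (Eventually.of_forall hC)
  · exact memLp_top_of_bound NonlocalGP.continuous_localBlackSoliton.aestronglyMeasurable 1
      (Eventually.of_forall fun x => (NonlocalGP.abs_localBlackSoliton_lt_one x).le)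
  · filter_upwards [hmem] with lam hlam
    exact ⟨(hu lam hlam).mem.hasWeakDeriv, (hu lam hlam).mem.weakDeriv_memLp⟩
  · exact ⟨NonlocalGP.memEnergyOdd_localBlackSoliton.hasWeakDeriv,
      NonlocalGP.memEnergyOdd_localBlackSoliton.weakDeriv_memLp⟩
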